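/- Let $X$ be a compact topological space with its Borel $\sigma$-algebra, $\mu$ a Borel probability measure on $X$, $T:X\to X$ an invertible bimeasurable map that preserves $\mu$ and is ergodic, $v\in C^0(X,\mathbb R)$ and $g>0$. Let $\ell^{2,g}(\mathbb Z)$ be the Hilbert space of complex sequences $u$ with $\sum_n|u_n|^2e^{2ng}<\infty$, with inner product $\sum_n u_n\overline{w_n}e^{2ng}$. For $x\in X$ let $\widetilde{\mathcal H}(g,x)$ be the bounded operator $$[\widetilde{\mathcal H}(g,x)u]_n=-e^{g}u_{n+1}-e^{-g}u_{n-1}+v(T^nx)u_n$$ on $\ell^{2,g}(\mathbb Z)$, and let $H(x)$ be the operator given by the same formula with $g=0$ on $\ell^2(\mathbb Z)$. Let $\widetilde{\mathcal H}_n(g,x)$ be the $n\times n$ tridiagonal matrix with diagonal entries $v(T^0x),\dots,v(T^{n-1}x)$, superdiagonal entries $-e^{g}$ and subdiagonal entries $-e^{-g}$ (Dirichlet boundary conditions), and let $\mathrm d\widetilde{\mathcal N}^{g,x}_n=\frac1n\sum_{j=1}^n\delta_{\widetilde E_j(g,x)}$, where $\widetilde E_1(g,x),\dots,\widetilde E_n(g,x)$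 are its eigenvalues counted with algebraic multiplicity. For $E\in\mathbb C$ let $$L(E)=\lim_{n\to\infty}\int_X\frac1n\log\|A_n(x)\|\,\mathrm d\mu(x),\qquad A_n(x)=S_E(T^{n-1}x)\cdots S_E(x),\qquad S_E(x)=\begin{pmatrix}v(x)-E&-1\\1&0\end{pmatrix};$$ this limit exists for every $E$. Let $m$ be Lebesgue measure on $\mathbb C$. Then: (1) The function $L$ is locally integrable, and $\mathrm d\widetilde{\mathcal N}^{g}:=\frac1{2\pi}\Delta L\,\mathrm dm$, with $\Delta L$ the distributional Laplacian, is a Borel probability measure on $\mathbb C$. For $\mu$-almost every $x\in X$, $$\mathrm d\widetilde{\mathcal N}^{g,x}_n\rightharpoonup \mathrm d\widetilde{\mathcal N}^{g}\quad\text{weakly as } n\to\infty .$$ If moreover $X$ is Hausdorff, $T$ is continuous and $\mu$ is the only $T$-invariant Borel probability measure on $X$, then this convergence holds for every $x\in X$. (2) There are sets $\widetilde\Sigma(g)$ and $\Sigma(0)$ such that the spectrum of $\widetilde{\mathcal H}(g,x)$ equals $\widetilde\Sigma(g)$ and the spectrum of $H(x)$ equals $\Sigma(0)$ for $\mu$-almost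 every $x\in X$, and $$\operatorname{supp}\mathrm d\widetilde{\mathcal N}^{g}=\widetilde\Sigma(g)=\Sigma(0).$$ -/

import Mathlib

open MeasureTheory Filter Topology
open scoped ComplexConjugate ENNReal ContDiff BoundedContinuousFunction

noncomputable section

namespace HatanoNelson

/-! ### The space of square summable sequences and the operator on it -/

/-- The Hilbert space `ℓ²(ℤ)` of square summable complex sequences. -/
abbrev L2Z : Type := lp (fun _ : ℤ => ℂ) 2

theorem memL2_iff (u : ℤ → ℂ) : Memℓp u 2 ↔ Summable fun n => ‖u n‖ ^ 2 := by
  rw [memℓp_gen_iff (by norm_num)]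
  norm_num

theorem L2Z_norm_sq (u : L2Z) : ‖u‖ ^ 2 = ∑' n : ℤ, ‖u n‖ ^ 2 := by
  have h := lp.norm_rpow_eq_tsum (p := 2) (by norm_num) u
  norm_num at h
  exact h

theorem L2Z_summable (u : L2Z) : Summable fun n : ℤ => ‖u n‖ ^ 2 :=
  (memL2_iff _).1 (lp.memℓp u)

/-- The translation `(u_n) ↦ (u_{n+k})` on `ℓ²(ℤ)`, an isometry. -/
def shift (k : ℤ) : L2Z →ₗᵢ[ℂ] L2Z where
  toFun u := ⟨fun n => u (n + k), (memL2_iff _).2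
    ((Equiv.addRight k).summable_iff.2 (L2Z_summable u))⟩
  map_add' _ _ := rfl
  map_smul' _ _ := rfl
  norm_map' u := by
    rw [← sq_eq_sq₀ (norm_nonneg _) (norm_nonneg _), L2Z_norm_sq, L2Z_norm_sq]
    exact (Equiv.addRight k).tsum_eq fun n : ℤ => ‖u n‖ ^ 2

theorem mul_bound (V : ℤ →ᵇ ℂ) (z : ℂ) (n : ℤ) : ‖V n * z‖ ^ 2 ≤ ‖V‖ ^ 2 * ‖z‖ ^ 2 := by
  rw [norm_mul, mul_pow]
  gcongr
  exact V.norm_coe_le_norm n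

/-- Multiplication by a bounded sequence `V` on `ℓ²(ℤ)`. -/
def mulOp (V : ℤ →ᵇ ℂ) : L2Z →L[ℂ] L2Z :=
  LinearMap.mkContinuous
    { toFun := fun u => ⟨fun n => V n * u n, (memL2_iff _).2
        (Summable.of_nonneg_of_le (fun _ => by positivity) (fun n => mul_bound V (u n) n)
          ((L2Z_summable u).mul_left _))⟩
      map_add' := fun _ _ => by
        ext n
        exact mul_add _ _ _
      map_smul' := fun _ _ => by
        ext n
        exact mul_left_comm _ _ _ }
    ‖V‖ fun u => by
      refine le_of_sq_le_sq ?_ (by positivity)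
      rw [mul_pow, L2Z_norm_sq, L2Z_norm_sq, ← tsum_mul_left]
      exact Summable.tsum_le_tsum (fun n => mul_bound V (u n) n)
        (Summable.of_nonneg_of_le (fun _ => by positivity) (fun n => mul_bound V (u n) n)
          ((L2Z_summable u).mul_left _))
        ((L2Z_summable u).mul_left _)

/-- The Hatano-Nelson operator `[𝓗(g)u]_n = -e^g u_{n+1} - e^{-g} u_{n-1} + V(n) u_n` on `ℓ²(ℤ)`;
its coordinates are given by `opL2_apply`. -/
def opL2 (g : ℝ) (V : ℤ →ᵇ ℂ) : L2Z →L[ℂ] L2Z :=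
  -((Real.exp g : ℂ) • (shift 1).toContinuousLinearMap)
    - (Real.exp (-g) : ℂ) • (shift (-1)).toContinuousLinearMap + mulOp V

theorem opL2_apply (g : ℝ) (V : ℤ →ᵇ ℂ) (u : L2Z) (n : ℤ) :
    opL2 g V u n
      = -(Real.exp g : ℂ) * u (n + 1) - (Real.exp (-g) : ℂ) * u (n - 1) + V n * u n := by
  rw [neg_mul]
  rfl

/-! ### The weighted Hilbert space -/

/-- The linear space of all sequences `u` with `∑ |u_n|² e^{2ng} < ∞`. -/
def weightedSubmodule (g : ℝ) : Submodule ℂ (ℤ → ℂ) where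
  carrier := {u | Summable fun n : ℤ => ‖u n‖ ^ 2 * Real.exp (2 * n * g)}
  zero_mem' := by simp [summable_zero]
  add_mem' := by
    intro u w hu hw
    refine Summable.of_nonneg_of_le (fun _ => by positivity) (fun n => ?_)
      ((hu.mul_left 2).add (hw.mul_left 2))
    have h1 : ‖u n + w n‖ ^ 2 ≤ 2 * ‖u n‖ ^ 2 + 2 * ‖w n‖ ^ 2 := by
      have := norm_add_le (u n) (w n)
      nlinarith [norm_nonneg (u n + w n), sq_nonneg (‖u n‖ - ‖w n‖)]
    have := mul_le_mul_of_nonneg_right h1 (Real.exp_pos (2 * n * g)).le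
    simp only [Pi.add_apply]
    linarith
  smul_mem' := by
    intro c u hu
    refine (hu.mul_left (‖c‖ ^ 2)).congr fun n => ?_
    simp only [Pi.smul_apply, smul_eq_mul, norm_mul]
    ring

/-- The weighted space `ℓ^{2,g}(ℤ)`, as a type of its own: its topology is the one of the weighted
norm, not the one of pointwise convergence. -/
def WeightedL2 (g : ℝ) : Type := weightedSubmodule g

namespace WeightedL2

variable {g : ℝ}

instance : AddCommGroup (WeightedL2 g) := inferInstanceAs (AddCommGroup (weightedSubmodule g))

instance : Module ℂ (WeightedL2 g) := inferInstanceAs (Module ℂ (weightedSubmodule g))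

instance : CoeFun (WeightedL2 g) fun _ => ℤ → ℂ := ⟨fun u => u.1⟩

theorem summable (u : WeightedL2 g) : Summable fun n : ℤ => ‖u n‖ ^ 2 * Real.exp (2 * n * g) := u.2

theorem exp_sq (n : ℤ) : Real.exp (n * g) ^ 2 = Real.exp (2 * n * g) := by
  rw [← Real.exp_nat_mul]
  congr 1
  push_cast
  ring

theorem norm_weight_sq (z : ℂ) (n : ℤ) :
    ‖(Real.exp (n * g) : ℂ) * z‖ ^ 2 = ‖z‖ ^ 2 * Real.exp (2 * n * g) := by
  rw [norm_mul, mul_pow, Complex.norm_real, Real.norm_eq_abs, abs_of_pos (Real.exp_pos _), exp_sq,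
    mul_comm]

/-- The map `(u_n) ↦ (e^{ng} u_n)` from `ℓ^{2,g}(ℤ)` to `ℓ²(ℤ)`. -/
def toL2 : WeightedL2 g →ₗ[ℂ] L2Z where
  toFun u := ⟨fun n => (Real.exp (n * g) : ℂ) * u n, (memL2_iff _).2
    ((summable u).congr fun n => (norm_weight_sq (u n) n).symm)⟩
  map_add' _ _ := by
    ext n
    exact mul_add _ _ _
  map_smul' _ _ := by
    ext n
    exact mul_left_comm _ _ _

theorem toL2_apply (u : WeightedL2 g) (n : ℤ) : toL2 u n = (Real.exp (n * g) : ℂ) * u n := rfl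

theorem toL2_injective : Function.Injective (toL2 (g := g)) := by
  intro u w h
  refine Subtype.ext (funext fun n => ?_)
  have h1 : toL2 u n = toL2 w n := by rw [h]
  rw [toL2_apply, toL2_apply] at h1
  exact mul_left_cancel₀ (by exact_mod_cast (Real.exp_pos _).ne') h1

/-- The weighted norm; `norm_sq` gives it explicitly. -/
instance : NormedAddCommGroup (WeightedL2 g) :=
  NormedAddCommGroup.induced _ _ (toL2 (g := g)) toL2_injective

theorem norm_toL2 (u : WeightedL2 g) : ‖toL2 u‖ = ‖u‖ := rfl

theorem norm_sq (u : WeightedL2 g) :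
    ‖u‖ ^ 2 = ∑' n : ℤ, ‖u n‖ ^ 2 * Real.exp (2 * n * g) := by
  rw [← norm_toL2, L2Z_norm_sq]
  exact tsum_congr fun n => norm_weight_sq (u n) n

instance : NormedSpace ℂ (WeightedL2 g) := NormedSpace.induced ℂ _ _ (toL2 (g := g))

theorem inner_toL2 (u w : WeightedL2 g) :
    inner ℂ (toL2 u) (toL2 w) = ∑' n : ℤ, conj (u n) * w n * (Real.exp (2 * n * g) : ℂ) := by
  rw [lp.inner_eq_tsum]
  refine tsum_congr fun n => ?_
  rw [toL2_apply, toL2_apply, RCLike.inner_apply, map_mul, Complex.conj_ofReal, ← exp_sq]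
  push_cast
  ring

/-- The inner product `∑ conj (u_n) w_n e^{2ng}` (conjugate linear in the first argument, as
everywhere in Mathlib). -/
instance : InnerProductSpace ℂ (WeightedL2 g) where
  inner u w := ∑' n : ℤ, conj (u n) * w n * (Real.exp (2 * n * g) : ℂ)
  norm_sq_eq_re_inner u := by
    rw [← inner_toL2, ← norm_toL2]
    exact norm_sq_eq_re_inner (𝕜 := ℂ) _
  conj_inner_symm u w := by
    rw [← inner_toL2, ← inner_toL2]
    exact inner_conj_symm _ _
  add_left u w z := by
    rw [← inner_toL2, ← inner_toL2, ← inner_toL2, map_add]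
    exact inner_add_left _ _ _
  smul_left u w c := by
    rw [← inner_toL2, ← inner_toL2, map_smul]
    exact inner_smul_left _ _ _

/-- The sequence `-e^g u_{n+1} - e^{-g} u_{n-1} + V(n) u_n`. -/
def opFun (g : ℝ) (V : ℤ →ᵇ ℂ) (u : ℤ → ℂ) (n : ℤ) : ℂ :=
  -(Real.exp g : ℂ) * u (n + 1) - (Real.exp (-g) : ℂ) * u (n - 1) + V n * u n

theorem weight_opFun (V : ℤ →ᵇ ℂ) (u : WeightedL2 g) (n : ℤ) :
    (Real.exp (n * g) : ℂ) * opFun g V u n = opL2 0 V (toL2 u) n := by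
  have h1 : (Real.exp ((n + 1 : ℤ) * g) : ℂ) = (Real.exp (n * g) : ℂ) * (Real.exp g : ℂ) := by
    rw [← Complex.ofReal_mul, ← Real.exp_add]
    congr 2
    push_cast
    ring
  have h2 : (Real.exp ((n - 1 : ℤ) * g) : ℂ) = (Real.exp (n * g) : ℂ) * (Real.exp (-g) : ℂ) := by
    rw [← Complex.ofReal_mul, ← Real.exp_add]
    congr 2
    push_cast
    ring
  rw [opL2_apply, toL2_apply, toL2_apply, toL2_apply, h1, h2, opFun]
  simp only [neg_zero, Real.exp_zero, Complex.ofReal_one]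
  ring

theorem opFun_mem (V : ℤ →ᵇ ℂ) (u : WeightedL2 g) : opFun g V u ∈ weightedSubmodule g :=
  (L2Z_summable (opL2 0 V (toL2 u))).congr fun n => by
    rw [← weight_opFun]
    exact norm_weight_sq _ _

end WeightedL2

/-- The Hatano-Nelson operator `[𝓗(g)u]_n = -e^g u_{n+1} - e^{-g} u_{n-1} + V(n) u_n` on the
weighted space `ℓ^{2,g}(ℤ)`. -/
def opWeighted (g : ℝ) (V : ℤ →ᵇ ℂ) : WeightedL2 g →L[ℂ] WeightedL2 g :=
  LinearMap.mkContinuous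
    { toFun := fun u => ⟨WeightedL2.opFun g V u, WeightedL2.opFun_mem V u⟩
      map_add' := fun u w => by
        refine Subtype.ext (funext fun n => ?_)
        change WeightedL2.opFun g V (fun k => u k + w k) n
          = WeightedL2.opFun g V u n + WeightedL2.opFun g V w n
        simp only [WeightedL2.opFun]
        ring
      map_smul' := fun c u => by
        refine Subtype.ext (funext fun n => ?_)
        change WeightedL2.opFun g V (fun k => c * u k) n = c * WeightedL2.opFun g V u n
        simp only [WeightedL2.opFun]
        ring }
    ‖opL2 0 V‖ fun u => by
      rw [← WeightedL2.norm_toL2, ← WeightedL2.norm_toL2]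
      refine le_of_eq_of_le ?_ ((opL2 0 V).le_opNorm _)
      congr 1
      ext n
      exact WeightedL2.weight_opFun V u n

theorem opWeighted_apply (g : ℝ) (V : ℤ →ᵇ ℂ) (u : WeightedL2 g) (n : ℤ) :
    opWeighted g V u n
      = -(Real.exp g : ℂ) * u (n + 1) - (Real.exp (-g) : ℂ) * u (n - 1) + V n * u n := rfl

/-! ### Dynamically defined potentials, Dirichlet truncations, Lyapunov exponent -/

section Dynamics

variable {X : Type*}

/-- The orbit map `x ↦ T^n x`, for every integer `n`, of a bijection `T`. -/
def orbit (T : X ≃ X) (n : ℤ) (x : X) : X := ((T : Equiv.Perm X) ^ n) x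

/-- The bounded potential `V(n) = v(T^n x)`. -/
def potential [TopologicalSpace X] [CompactSpace X] (T : X ≃ X) (v : C(X, ℝ)) (x : X) : ℤ →ᵇ ℂ :=
  BoundedContinuousFunction.ofNormedAddCommGroup (fun n => ((v (orbit T n x) : ℝ) : ℂ))
    continuous_of_discreteTopology ‖v‖ fun n => by
      rw [Complex.norm_real]
      exact v.norm_coe_le_norm _

/-- The truncation of the Hatano-Nelson operator to `{0, …, n-1}` with Dirichlet boundary
conditions. -/
def truncation (T : X ≃ X) (v : X → ℝ) (g : ℝ) (x : X) (n : ℕ) : Matrix (Fin n) (Fin n) ℂ :=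
  Matrix.of fun i j =>
    if (j : ℕ) = i + 1 then -(Real.exp g : ℂ)
    else if (i : ℕ) = j + 1 then -(Real.exp (-g) : ℂ)
    else if i = j then ((v (orbit T (i : ℕ) x) : ℝ) : ℂ)
    else 0

/-- The normalized eigenvalue counting measure `(1/n) ∑_j δ_{E_j}` of an `n × n` matrix, the
eigenvalues `E_1, …, E_n` being counted with their algebraic multiplicities. -/
def countingMeasure {n : ℕ} (M : Matrix (Fin n) (Fin n) ℂ) : Measure ℂ :=
  (n : ℝ≥0∞)⁻¹ • (M.charpoly.roots.map fun E => Measure.dirac E).sum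

/-- The one-step transfer matrix of the Schrödinger operator at energy `E`. -/
def schrodingerMatrix (v : X → ℝ) (E : ℂ) (x : X) : Matrix (Fin 2) (Fin 2) ℂ :=
  !![(v x : ℂ) - E, -1; 1, 0]

/-- The transfer matrix `A_n(x) = S_E(T^{n-1} x) ⋯ S_E(T x) S_E(x)`. -/
def transferMatrix (T : X ≃ X) (v : X → ℝ) (E : ℂ) : ℕ → X → Matrix (Fin 2) (Fin 2) ℂ
  | 0, _ => 1
  | n + 1, x => schrodingerMatrix v E (orbit T n x) * transferMatrix T v E n x

open scoped Matrix.Norms.L2Operator in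
/-- The finite-scale Lyapunov exponent `∫ (1/n) log ‖A_n(x)‖ dμ(x)`. -/
def finiteLyapunov [MeasurableSpace X] (μ : Measure X) (T : X ≃ X) (v : X → ℝ) (E : ℂ) (n : ℕ) :
    ℝ :=
  ∫ x, (1 / (n : ℝ)) * Real.log ‖transferMatrix T v E n x‖ ∂μ

/-- The Lyapunov exponent `L(E) = lim_n ∫ (1/n) log ‖A_n(x)‖ dμ(x)` of the Schrödinger cocycle. -/
def lyapunov [MeasurableSpace X] (μ : Measure X) (T : X ≃ X) (v : X → ℝ) (E : ℂ) : ℝ :=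
  limUnder atTop (finiteLyapunov μ T v E)

/-- `(X, T)` is uniquely ergodic with invariant measure `μ`: `T` is continuous, and `μ` is its
only invariant Borel probability measure. -/
def IsUniquelyErgodic [TopologicalSpace X] [MeasurableSpace X] (T : X ≃ X) (μ : Measure X) : Prop :=
  Continuous T ∧ MeasurePreserving T μ μ ∧
    ∀ ν : Measure X, IsProbabilityMeasure ν → MeasurePreserving T ν ν → ν = μ

end Dynamics

/-! ### Weak convergence and the distributional Laplacian -/

/-- Weak convergence of measures on `ℂ`, tested on bounded continuous functions. -/
def WeaklyConverges (ν : ℕ → Measure ℂ) (N : Measure ℂ) : Prop :=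
  ∀ f : ℂ →ᵇ ℝ, Tendsto (fun n => ∫ z, f z ∂(ν n)) atTop (𝓝 (∫ z, f z ∂N))

/-- `N = (1/2π) Δ L dm` with `m` the Lebesgue measure on `ℂ` and `Δ L` the distributional
Laplacian of the locally integrable function `L`. -/
def IsRieszMeasure (L : ℂ → ℝ) (N : Measure ℂ) : Prop :=
  LocallyIntegrable L volume ∧ IsLocallyFiniteMeasure N ∧
    ∀ φ : ℂ → ℝ, ContDiff ℝ ∞ φ → HasCompactSupport φ →
      ∫ z, φ z ∂N = (1 / (2 * Real.pi)) * ∫ z, L z * Laplacian.laplacian φ z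

end HatanoNelson

end

/-! The parameter `g` is a gauge. The map `(u_n) ↦ (e^{ng} u_n)` carries the weighted operator
isometrically to `H(x)` (`spectrum_opWeighted`), and the same diagonal conjugation makes the
Dirichlet matrices Hermitian without changing their characteristic polynomials
(`charpoly_truncation`). What remains is the density of states of the self-adjoint family `H(x)`:
the measure on `ℝ` representing `φ ↦ ∫ ⟨δ₀, φ(H(x)) δ₀⟩ dμ` (`exists_densityOfStates`), pushed
forward to `ℂ`.

Convergence. For a polynomial `p`, finite propagation makes the trace of `p` of the truncation equal
to the sum of the `⟨δ_i, p(H(x)) δ_i⟩` up to a bounded boundary term (`exists_trace_sub_le`). By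
covariance this sum is a Birkhoff sum of a bounded function. Its averages converge almost everywhere
by Birkhoff's theorem, and everywhere in the uniquely ergodic case, where the function is
continuous. Since all functionals involved are contractions for the supremum norm on one interval,
Weierstrass approximation passes from polynomials to continuous functions.

Spectrum. If the density of states does not charge an interval, then for almost every `x` a function
positive exactly there is annihilated by the functional calculus at every `δ_i`, so the spectrum
misses the interval. Conversely, if the spectrum of one generic `H(x)` misses the interval, the site
averages vanish and so does their limit (`ae_real_spectrum_eq_support`).

Laplacian. The upper left entry of the transfer matrix is, up to sign, the characteristic polynomial
of the truncation. Off the real axis it dominates the whole matrix up to a constant, by a Riccati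
argument. Hence `L(E) = ∫ log |E - t| dN(t)` there (`lyapunov_eq_dosFunctional`), that is, Lebesgue
almost everywhere, and `(1/2π) log |z|` is the fundamental solution of the Laplacian. -/

noncomputable section

namespace HatanoNelson

/-! ### Birkhoff's ergodic theorem through a maximal inequality -/

section Birkhoff

variable {X : Type*} [MeasurableSpace X] {μ : Measure X} {T : X → X} {f : X → ℝ}

/-- The running maximum `max_{1 ≤ k ≤ n+1} S_k` of the Birkhoff sums of `f`. -/
def maxBirkhoffSum (T : X → X) (f : X → ℝ) : ℕ → X → ℝ
  | 0, x => f x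
  | n + 1, x => f x + max 0 (maxBirkhoffSum T f n (T x))

theorem measurable_maxBirkhoffSum (hT : Measurable T) (hf : Measurable f) (n : ℕ) :
    Measurable (maxBirkhoffSum T f n) := by
  induction n with
  | zero => exact hf
  | succ n ih => exact hf.add (measurable_const.max (ih.comp hT))

theorem abs_maxBirkhoffSum_le {C : ℝ} (hC : ∀ x, |f x| ≤ C) (n : ℕ) (x : X) :
    |maxBirkhoffSum T f n x| ≤ (n + 1) * C := by
  induction n generalizing x with
  | zero => simpa [maxBirkhoffSum] using hC x
  | succ n ih =>
    have h := abs_le.1 (ih (T x))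
    have h0 := abs_le.1 (hC x)
    have : 0 ≤ (n + 1) * C := (abs_nonneg _).trans (ih (T x))
    have hm : max 0 (maxBirkhoffSum T f n (T x)) ≤ (n + 1) * C := max_le this h.2
    have hm0 : 0 ≤ max 0 (maxBirkhoffSum T f n (T x)) := le_max_left _ _
    simp only [maxBirkhoffSum]
    push_cast
    exact abs_le.2 ⟨by linarith, by linarith⟩

theorem monotone_maxBirkhoffSum (x : X) : Monotone fun n => maxBirkhoffSum T f n x := by
  refine monotone_nat_of_le_succ fun n => ?_
  induction n generalizing x with
  | zero => simp [maxBirkhoffSum]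
  | succ n ih =>
    simp only [maxBirkhoffSum]
    have := max_le_max (le_refl (0 : ℝ)) (ih (T x))
    simp only [maxBirkhoffSum] at this
    linarith

theorem birkhoffSum_le_maxBirkhoffSum (n : ℕ) (x : X) :
    birkhoffSum T f (n + 1) x ≤ maxBirkhoffSum T f n x := by
  induction n generalizing x with
  | zero => simp [maxBirkhoffSum]
  | succ n ih =>
    rw [birkhoffSum_succ']
    simp only [maxBirkhoffSum]
    have := (ih (T x)).trans (le_max_right 0 _)
    linarith

/-- Let `E` be the set where the running maxima `M n` are unbounded. It is invariant, so ergodicity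
leaves only measure zero or full measure. On `E`, `M (n+1) - M n ∘ T` tends to `f` and has
nonnegative integral, whence `∫_E f ≥ 0`; with a negative mean, `E` cannot have full measure. -/
theorem ae_bddAbove_birkhoffSum [IsProbabilityMeasure μ] (hT : Ergodic T μ) (hf : Measurable f)
    {C : ℝ} (hC : ∀ x, |f x| ≤ C) (hneg : ∫ x, f x ∂μ < 0) :
    ∀ᵐ x ∂μ, ∃ B : ℝ, ∀ n, birkhoffSum T f (n + 1) x ≤ B := by
  set M := maxBirkhoffSum T f with hM
  have hMm := measurable_maxBirkhoffSum (f := f) hT.measurable hf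
  let E : Set X := {x | ∀ B : ℕ, ∃ n, (B : ℝ) < M n x}
  have hE : MeasurableSet E := by
    have : E = ⋂ B : ℕ, ⋃ n, {x | (B : ℝ) < M n x} := by
      ext x
      simp [E]
    rw [this]
    exact MeasurableSet.iInter fun B => MeasurableSet.iUnion fun n =>
      measurableSet_lt measurable_const (hMm n)
  -- Passing from `T x` to `x` adds `f x`, which costs at most `C` and does not affect
  -- unboundedness; hence the thresholds `⌈B + C⌉`.
  have hinv : T ⁻¹' E = E := by
    ext x
    simp only [E, Set.mem_preimage, Set.mem_ofPred_eq]
    have hx := abs_le.1 (hC x)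
    constructor
    · intro h B
      obtain ⟨n, hn⟩ := h (⌈(B : ℝ) + C⌉₊)
      refine ⟨n + 1, ?_⟩
      have h1 := Nat.le_ceil ((B : ℝ) + C)
      have h2 := le_max_right 0 (M n (T x))
      simp only [hM, maxBirkhoffSum] at h2 hn ⊢
      linarith
    · intro h B
      obtain ⟨n, hn⟩ := h (⌈(B : ℝ) + C⌉₊)
      have h1 := Nat.le_ceil ((B : ℝ) + C)
      have h3 : M n x ≤ M (n + 1) x := monotone_maxBirkhoffSum x n.le_succ
      refine ⟨n, ?_⟩
      have h2 : (B : ℝ) < max 0 (M n (T x)) := by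
        simp only [hM, maxBirkhoffSum] at h3 hn ⊢
        linarith
      exact (lt_max_iff.1 h2).resolve_left (not_lt.2 B.cast_nonneg)
  have hMi : ∀ n, Integrable (M n) μ := fun n =>
    Integrable.of_bound (hMm n).aestronglyMeasurable ((n + 1) * C)
      (ae_of_all _ fun x => abs_maxBirkhoffSum_le hC n x)
  have hTE : MeasurePreserving T (μ.restrict E) (μ.restrict E) := by
    have := hT.toMeasurePreserving.restrict_preimage hE
    rwa [hinv] at this
  have hMTi : ∀ n, Integrable (fun x => M n (T x)) (μ.restrict E) := fun n =>
    hTE.integrable_comp_of_integrable (hMi n).integrableOn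
  -- By invariance of `E` and `μ`, `M n ∘ T` and `M n` have the same integral over `E`, and `M`
  -- increases with `n`.
  have hnonneg : ∀ n, 0 ≤ ∫ x in E, (M (n + 1) x - M n (T x)) ∂μ := by
    intro n
    rw [integral_sub (hMi (n + 1)).integrableOn (hMTi n)]
    have h1 : ∫ x in E, M n (T x) ∂μ = ∫ x in E, M n x ∂μ := by
      have h := integral_map (μ := μ.restrict E) (φ := T) hT.measurable.aemeasurable
        (f := M n) (hMm n).aestronglyMeasurable
      rw [hTE.map_eq] at h
      exact h.symm
    rw [h1, sub_nonneg]
    exact integral_mono (hMi n).integrableOn (hMi (n + 1)).integrableOn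
      fun x => monotone_maxBirkhoffSum x n.le_succ
  -- The integrand is `f` plus the negative part of `M n ∘ T`. That part is at most `C`, because `M
  -- n ≥ M 0 = f`, and it vanishes for large `n` at points of `E`.
  have hlim : Tendsto (fun n => ∫ x in E, (M (n + 1) x - M n (T x)) ∂μ) atTop
      (𝓝 (∫ x in E, f x ∂μ)) := by
    refine tendsto_integral_of_dominated_convergence (fun _ => 2 * C)
      (fun n => ((hMm (n + 1)).sub ((hMm n).comp hT.measurable)).aestronglyMeasurable)
      (integrable_const _) (fun n => ae_of_all _ fun x => ?_) ?_
    · have h0 : M 0 (T x) ≤ M n (T x) := monotone_maxBirkhoffSum (T x) (Nat.zero_le n)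
      have h1 := abs_le.1 (hC x)
      have h2 := abs_le.1 (hC (T x))
      simp only [hM, maxBirkhoffSum] at h0 ⊢
      rw [Real.norm_eq_abs, abs_le]
      rcases max_cases 0 (maxBirkhoffSum T f n (T x)) with h | h <;> rw [h.1] <;>
        constructor <;> linarith
    · refine (ae_restrict_iff' hE).2 (ae_of_all _ fun x hx => ?_)
      have hx' : T x ∈ E := by rwa [← Set.mem_preimage, hinv]
      obtain ⟨n0, hn0⟩ := hx' 0
      refine tendsto_const_nhds.congr' ?_
      filter_upwards [eventually_ge_atTop n0] with n hn
      have h1 : M n0 (T x) ≤ M n (T x) := monotone_maxBirkhoffSum (T x) hn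
      have h2 : (0 : ℝ) ≤ M n (T x) := by
        push_cast at hn0
        linarith
      simp only [hM, maxBirkhoffSum] at h2 ⊢
      rw [max_eq_right h2]
      ring
  have hge : 0 ≤ ∫ x in E, f x ∂μ := ge_of_tendsto' hlim hnonneg
  have hnull : ∀ᵐ x ∂μ, x ∉ E := by
    rcases hT.toPreErgodic.ae_empty_or_univ hE hinv with h | h
    · filter_upwards [h] with x hx hxE
      exact (hx.symm.mpr hxE : x ∈ (∅ : Set X))
    · rw [setIntegral_congr_set h, setIntegral_univ] at hge
      linarith
  filter_upwards [hnull] with x hx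
  simp only [E, Set.mem_ofPred_eq, not_forall, not_exists, not_lt] at hx
  obtain ⟨B, hB⟩ := hx
  exact ⟨B, fun n => (birkhoffSum_le_maxBirkhoffSum n x).trans (hB n)⟩

/-- Subtracting a constant `b` strictly between the mean and `a` makes the mean negative. The sums
of `f - b` are then bounded by some `B`, so the averages of `f` are at most `B / n + b`. -/
theorem ae_eventually_birkhoffAverage_lt [IsProbabilityMeasure μ] (hT : Ergodic T μ)
    (hf : Measurable f) {C : ℝ} (hC : ∀ x, |f x| ≤ C) {a : ℝ} (ha : ∫ x, f x ∂μ < a) :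
    ∀ᵐ x ∂μ, ∀ᶠ n in atTop, birkhoffAverage ℝ T f n x < a := by
  obtain ⟨b, hb, hba⟩ := exists_between ha
  have hi : Integrable f μ := Integrable.of_bound hf.aestronglyMeasurable C (ae_of_all _ hC)
  have h1 := ae_bddAbove_birkhoffSum (f := fun x => f x - b) hT (hf.sub_const b)
    (C := C + |b|) (fun x => (abs_sub _ _).trans (by linarith [hC x]))
    (by rw [integral_sub hi (integrable_const _)]; simpa using hb)
  filter_upwards [h1] with x hx
  obtain ⟨B, hB⟩ := hx
  have h2 : Tendsto (fun n : ℕ => B / (n : ℝ) + b) atTop (𝓝 (0 + b)) :=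
    (tendsto_const_div_atTop_nhds_zero_nat B).add_const b
  rw [zero_add] at h2
  filter_upwards [h2.eventually_lt_const hba, eventually_gt_atTop 0] with n hn hn0
  refine lt_of_le_of_lt ?_ hn
  obtain ⟨m, rfl⟩ := Nat.exists_eq_succ_of_ne_zero hn0.ne'
  have h3 := hB m
  have hpos : (0 : ℝ) < (m + 1 : ℕ) := by positivity
  simp only [birkhoffSum, Finset.sum_sub_distrib, Finset.sum_const, Finset.card_range,
    nsmul_eq_mul] at h3
  rw [birkhoffAverage, birkhoffSum, smul_eq_mul, inv_mul_eq_div, div_add' _ _ _ hpos.ne']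
  gcongr
  simp only [Nat.succ_eq_add_one] at *
  linarith

/-- **Birkhoff's pointwise ergodic theorem** for bounded functions. -/
theorem ae_tendsto_birkhoffAverage [IsProbabilityMeasure μ] (hT : Ergodic T μ)
    (hf : Measurable f) {C : ℝ} (hC : ∀ x, |f x| ≤ C) :
    ∀ᵐ x ∂μ, Tendsto (fun n => birkhoffAverage ℝ T f n x) atTop (𝓝 (∫ x, f x ∂μ)) := by
  have h1 : ∀ᵐ x ∂μ, ∀ k : ℕ, ∀ᶠ n in atTop,
      birkhoffAverage ℝ T f n x < ∫ x, f x ∂μ + 1 / ((k : ℝ) + 1) :=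
    ae_all_iff.2 fun k => ae_eventually_birkhoffAverage_lt hT hf hC
      (lt_add_of_pos_right _ (by positivity))
  have h2 : ∀ᵐ x ∂μ, ∀ k : ℕ, ∀ᶠ n in atTop,
      birkhoffAverage ℝ T (-f) n x < -∫ x, f x ∂μ + 1 / ((k : ℝ) + 1) :=
    ae_all_iff.2 fun k => ae_eventually_birkhoffAverage_lt hT hf.neg (C := C)
      (fun x => by simpa using hC x)
      (by
        simp only [Pi.neg_apply, integral_neg]
        exact lt_add_of_pos_right _ (by positivity))
  filter_upwards [h1, h2] with x hx1 hx2
  refine Metric.tendsto_atTop'.2 fun ε hε => ?_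
  obtain ⟨k, hk⟩ := exists_nat_one_div_lt hε
  obtain ⟨N, hN⟩ := eventually_atTop.1 ((hx1 k).and (hx2 k))
  refine ⟨N, fun n hn => ?_⟩
  obtain ⟨h3, h4⟩ := hN n hn.le
  rw [birkhoffAverage_neg] at h4
  simp only [Pi.neg_apply] at h4
  rw [Real.dist_eq, abs_lt]
  constructor <;> linarith

end Birkhoff

/-! ### Riesz representation and unique ergodicity -/

section Representation

variable {X : Type*} [TopologicalSpace X] [CompactSpace X] [T2Space X] [MeasurableSpace X]
  [BorelSpace X]

open CompactlySupported in
/-- The Riesz–Markov–Kakutani theorem for normalized positive functionals on `C(X, ℝ)`. -/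
theorem exists_regular_measure_of_functional (Λ : C(X, ℝ) → ℝ)
    (hadd : ∀ f h, Λ (f + h) = Λ f + Λ h) (hsmul : ∀ (c : ℝ) f, Λ (c • f) = c * Λ f)
    (hmono : ∀ f h, f ≤ h → Λ f ≤ Λ h) (hone : Λ 1 = 1) :
    ∃ ν : Measure X, ν.Regular ∧ IsProbabilityMeasure ν ∧ ∀ f : C(X, ℝ), ∫ x, f x ∂ν = Λ f := by
  let Λ' : C_c(X, ℝ) →ₚ[ℝ] ℝ :=
    { toFun h := Λ h
      map_add' h h' := hadd h h'
      map_smul' c h := hsmul c h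
      monotone' h h' hh := hmono h h' hh }
  have hint : ∀ f : C(X, ℝ), ∫ x, f x ∂(RealRMK.rieszMeasure Λ') = Λ f := fun f =>
    RealRMK.integral_rieszMeasure Λ'
      { toFun := f
        hasCompactSupport' := HasCompactSupport.of_compactSpace _ }
  refine ⟨RealRMK.rieszMeasure Λ', inferInstance, ⟨?_⟩, hint⟩
  have h1 := hint 1
  rw [hone] at h1
  simp only [ContinuousMap.one_apply, integral_const, smul_eq_mul, mul_one] at h1
  rw [measureReal_def, ENNReal.toReal_eq_one_iff] at h1
  exact h1

/-- The Birkhoff averages of a continuous function under a uniquely ergodic homeomorphism converge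
at every point. -/
theorem tendsto_birkhoffAverage_of_unique {μ : Measure X} (T : X ≃ₜ X)
    (huniq : ∀ ν : Measure X, IsProbabilityMeasure ν → MeasurePreserving T ν ν → ν = μ)
    (f : C(X, ℝ)) (x : X) :
    Tendsto (fun n => birkhoffAverage ℝ T f n x) atTop (𝓝 (∫ y, f y ∂μ)) := by
  have hbd : ∀ (h : C(X, ℝ)) (n : ℕ), birkhoffAverage ℝ T h n x ∈ Set.Icc (-‖h‖) ‖h‖ := by
    intro h n
    rw [Set.mem_Icc, ← abs_le]
    rcases Nat.eq_zero_or_pos n with rfl | hn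
    · simp
    rw [birkhoffAverage, smul_eq_mul, abs_mul, abs_inv, Nat.abs_cast,
      inv_mul_le_iff₀ (by exact_mod_cast hn)]
    refine (Finset.abs_sum_le_sum_abs _ _).trans
      ((Finset.sum_le_card_nsmul _ _ ‖h‖ fun i _ => h.norm_coe_le_norm _).trans ?_)
    simp
  -- Along an ultrafilter all averages converge by compactness. Their limits form a positive
  -- normalized functional, represented by a measure which is shown to be invariant, hence equal to
  -- `μ`.
  rw [tendsto_iff_ultrafilter]
  intro u hu
  have hlim : ∀ h : C(X, ℝ), ∃ a, Tendsto (fun n => birkhoffAverage ℝ T h n x) u (𝓝 a) := by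
    intro h
    obtain ⟨a, -, ha⟩ := isCompact_Icc.ultrafilter_le_nhds
      (u.map fun n => birkhoffAverage ℝ T h n x)
      (by
        rw [le_principal_iff]
        exact mem_map.2 (univ_mem' fun n => hbd h n))
    exact ⟨a, ha⟩
  choose Λ hΛ using hlim
  obtain ⟨ν, hreg, hprob, hν⟩ := exists_regular_measure_of_functional Λ
    (fun f h => by
      refine tendsto_nhds_unique (hΛ _) (((hΛ f).add (hΛ h)).congr fun n => ?_)
      rw [ContinuousMap.coe_add, birkhoffAverage_add]
      rfl)
    (fun c f => by
      refine tendsto_nhds_unique (hΛ _) (((hΛ f).const_mul c).congr fun n => ?_)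
      simp only [birkhoffAverage, birkhoffSum, ContinuousMap.smul_apply, smul_eq_mul,
        ← Finset.mul_sum]
      ring)
    (fun f h hfh => by
      refine le_of_tendsto_of_tendsto' (hΛ f) (hΛ h) fun n => ?_
      simp only [birkhoffAverage, birkhoffSum, smul_eq_mul]
      gcongr
      exact hfh _)
    (by
      refine tendsto_nhds_unique (hΛ _) (tendsto_const_nhds.congr' ?_)
      filter_upwards [hu (eventually_gt_atTop 0)] with n hn
      have : (n : ℝ) ≠ 0 := by exact_mod_cast (ne_of_gt hn)
      simp [birkhoffAverage, birkhoffSum, this])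
  -- Averages started at `T x` and at `x` differ only by two end terms divided by `n`.
  have hinv : ∀ h : C(X, ℝ), ∫ y, h (T y) ∂ν = ∫ y, h y ∂ν := by
    intro h
    rw [hν h]
    refine (hν (h.comp T)).trans (tendsto_nhds_unique (hΛ _) ?_)
    have h1 : Tendsto (fun n => birkhoffAverage ℝ T h n (T x) - birkhoffAverage ℝ T h n x) u
        (𝓝 0) := (tendsto_birkhoffAverage_apply_sub_birkhoffAverage' ℝ
          (isCompact_range h.continuous).isBounded T x).mono_left hu
    have h2 := h1.add (hΛ h)
    rw [zero_add] at h2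
    refine h2.congr fun n => ?_
    rw [sub_add_cancel]
    simp only [birkhoffAverage, birkhoffSum]
    congr 1
    refine Finset.sum_congr rfl fun k _ => ?_
    rw [← Function.iterate_succ_apply, Function.iterate_succ_apply']
    rfl
  -- `X` need not be metrizable, so integrals of continuous functions determine a measure only among
  -- regular ones; `ν` and its image under the homeomorphism `T` are both regular.
  have hmp : MeasurePreserving T ν ν := by
    refine ⟨T.continuous.measurable, ?_⟩
    have : (ν.map T).Regular := Measure.Regular.map T
    refine Measure.ext_of_integral_eq_on_compactlySupported fun h => ?_
    exact (integral_map T.continuous.measurable.aemeasurable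
      (map_continuous h).aestronglyMeasurable).trans (hinv h)
  rw [← huniq ν hprob hmp, hν]
  exact hΛ f

end Representation

/-! ### Quadratic forms of the functional calculus -/

section SpectralFunctional

variable {E : Type*} [NormedAddCommGroup E] [InnerProductSpace ℂ E] [CompleteSpace E]
  {A : E →L[ℂ] E} {e : E} {φ ψ : ℝ → ℝ}

/-- The quadratic form `⟨e, φ(A) e⟩` of the functional calculus of a self-adjoint operator. -/
def spectralFunctional (A : E →L[ℂ] E) (e : E) (φ : ℝ → ℝ) : ℝ :=
  (inner ℂ e (cfc φ A e)).re

theorem mem_spectrum_real_iff {t : ℝ} : t ∈ spectrum ℝ A ↔ (t : ℂ) ∈ spectrum ℂ A :=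
  (spectrum.algebraMap_mem_iff ℂ).symm

theorem spectrum_complex_eq_image (hA : IsSelfAdjoint A) :
    spectrum ℂ A = Complex.ofReal '' {t : ℝ | (t : ℂ) ∈ spectrum ℂ A} := by
  conv_lhs => rw [← hA.spectrumRestricts.algebraMap_image]
  congr 1

theorem abs_le_of_mem_spectrum {R : ℝ} (hR : ‖A‖ ≤ R) {t : ℝ} (ht : t ∈ spectrum ℝ A) :
    t ∈ Set.Icc (-R) R := by
  have h1 := spectrum.norm_le_norm_mul_of_mem (mem_spectrum_real_iff.1 ht)
  have h2 : ‖(1 : E →L[ℂ] E)‖ ≤ 1 := ContinuousLinearMap.norm_id_le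
  rw [Complex.norm_real, Real.norm_eq_abs] at h1
  rw [Set.mem_Icc, ← abs_le]
  nlinarith [norm_nonneg A]

theorem spectralFunctional_add (hφ : Continuous φ) (hψ : Continuous ψ) :
    spectralFunctional A e (φ + ψ) = spectralFunctional A e φ + spectralFunctional A e ψ := by
  have : cfc (φ + ψ) A = cfc φ A + cfc ψ A :=
    cfc_add A φ ψ hφ.continuousOn hψ.continuousOn
  simp [spectralFunctional, this]

theorem spectralFunctional_smul (c : ℝ) (hφ : Continuous φ) :
    spectralFunctional A e (c • φ) = c * spectralFunctional A e φ := by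
  have : cfc (c • φ) A = c • cfc φ A := cfc_smul c φ A hφ.continuousOn
  rw [spectralFunctional, this, spectralFunctional, smul_apply,
    ← Complex.coe_smul, inner_smul_right]
  simp

theorem spectralFunctional_one (hA : IsSelfAdjoint A) (he : ‖e‖ = 1) :
    spectralFunctional A e (fun _ => 1) = 1 := by
  rw [spectralFunctional, cfc_const_one ℝ A hA, one_apply_eq_self,
    inner_self_eq_norm_sq_to_K, he]
  simp

theorem spectralFunctional_congr (h : Set.EqOn φ ψ (spectrum ℝ A)) :
    spectralFunctional A e φ = spectralFunctional A e ψ := by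
  rw [spectralFunctional, cfc_congr h, spectralFunctional]

theorem spectralFunctional_sq (hA : IsSelfAdjoint A) (hφ : Continuous φ) :
    spectralFunctional A e (fun t => φ t ^ 2) = ‖cfc φ A e‖ ^ 2 := by
  have h1 : cfc (fun t => φ t ^ 2) A = cfc φ A * cfc φ A := by
    rw [cfc_pow φ 2 A hφ.continuousOn, sq]
  have h2 : IsSelfAdjoint (cfc φ A) := cfc_predicate φ A
  have h3 := (ContinuousLinearMap.isSelfAdjoint_iff_isSymmetric.1 h2) e (cfc φ A e)
  simp only [ContinuousLinearMap.coe_coe] at h3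
  rw [spectralFunctional, h1, mul_apply_eq_comp, ← h3, inner_self_eq_norm_sq_to_K]
  norm_cast

/-- Only the values on the spectrum count, and there `φ` is the square of the continuous function
`√φ`, so the form is a squared norm. -/
theorem spectralFunctional_nonneg (hA : IsSelfAdjoint A) (hφ : Continuous φ)
    (h : ∀ t ∈ spectrum ℝ A, 0 ≤ φ t) : 0 ≤ spectralFunctional A e φ := by
  have h1 : spectralFunctional A e φ = spectralFunctional A e (fun t => √(φ t) ^ 2) :=
    spectralFunctional_congr fun t ht => (Real.sq_sqrt (h t ht)).symm
  rw [h1, spectralFunctional_sq hA hφ.sqrt]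
  positivity

theorem spectralFunctional_mono (hA : IsSelfAdjoint A) (hφ : Continuous φ) (hψ : Continuous ψ)
    (h : ∀ t ∈ spectrum ℝ A, φ t ≤ ψ t) :
    spectralFunctional A e φ ≤ spectralFunctional A e ψ := by
  have hφ' : Continuous ((-1 : ℝ) • φ) := hφ.const_smul (-1 : ℝ)
  have h1 := spectralFunctional_nonneg (e := e) hA (hψ.add hφ') fun t ht => by
    have := h t ht
    simp only [Pi.add_apply, Pi.smul_apply, smul_eq_mul]
    linarith
  rw [spectralFunctional_add hψ hφ', spectralFunctional_smul _ hφ] at h1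
  linarith

/-- Positivity and normalization bound the functional by the supremum norm on the spectrum. This is
what makes Weierstrass approximation applicable. -/
theorem abs_spectralFunctional_sub_le (hA : IsSelfAdjoint A) (he : ‖e‖ = 1) (hφ : Continuous φ)
    (hψ : Continuous ψ) {ε : ℝ} (h : ∀ t ∈ spectrum ℝ A, |φ t - ψ t| ≤ ε) :
    |spectralFunctional A e φ - spectralFunctional A e ψ| ≤ ε := by
  have key : ∀ {φ ψ : ℝ → ℝ}, Continuous φ → Continuous ψ →
      (∀ t ∈ spectrum ℝ A, φ t ≤ ψ t + ε) →
      spectralFunctional A e φ ≤ spectralFunctional A e ψ + ε := by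
    intro φ ψ hφ hψ h
    have hc : Continuous (ε • fun _ : ℝ => (1 : ℝ)) := continuous_const
    have h1 := spectralFunctional_mono (e := e) hA hφ
      (ψ := ψ + ε • fun _ => 1) (hψ.add hc) (fun t ht => by simpa using h t ht)
    rwa [spectralFunctional_add hψ hc,
      spectralFunctional_smul _ continuous_const, spectralFunctional_one hA he, mul_one] at h1
  have h1 := key hφ hψ fun t ht => by linarith [(abs_le.1 (h t ht)).2]
  have h2 := key hψ hφ fun t ht => by linarith [(abs_le.1 (h t ht)).1]
  exact abs_le.2 ⟨by linarith, by linarith⟩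

theorem spectralFunctional_polynomial (hA : IsSelfAdjoint A) (p : Polynomial ℝ) :
    spectralFunctional A e (fun t => p.eval t)
      = (inner ℂ e (Polynomial.aeval A (p.map (algebraMap ℝ ℂ)) e)).re := by
  rw [spectralFunctional, cfc_polynomial p A hA, Polynomial.aeval_map_algebraMap]

/-- A function vanishes on the spectrum if its square has vanishing quadratic form on a set of
vectors with dense span. -/
theorem eq_zero_on_spectrum_of_spectralFunctional (hA : IsSelfAdjoint A) (hφ : Continuous φ)
    {s : Set E} (hs : Dense (Submodule.span ℂ s : Set E))
    (h : ∀ e ∈ s, spectralFunctional A e (fun t => φ t ^ 2) = 0) :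
    ∀ t : ℝ, (t : ℂ) ∈ spectrum ℂ A → φ t = 0 := by
  intro t ht
  -- Each form is `‖φ(A) e‖²`, so `φ(A)` vanishes on a set with dense span. The spectral mapping
  -- theorem then puts the values of `φ` in the spectrum of `0`.
  have h0 : cfc φ A = 0 := by
    refine ContinuousLinearMap.ext_on hs fun e he => ?_
    have := h e he
    rw [spectralFunctional_sq hA hφ] at this
    simpa using this
  have h1 := cfc_map_spectrum φ A hA hφ.continuousOn
  rw [h0] at h1
  have h2 : φ t ∈ spectrum ℝ (0 : E →L[ℂ] E) := by
    rw [h1]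
    exact ⟨t, mem_spectrum_real_iff.2 ht, rfl⟩
  have h3 := abs_le_of_mem_spectrum (R := 0) (by simp) h2
  simp only [neg_zero, Set.Icc_self, Set.mem_singleton_iff] at h3
  exact h3

theorem spectralFunctional_eq_zero (h : ∀ t : ℝ, (t : ℂ) ∈ spectrum ℂ A → φ t = 0) :
    spectralFunctional A e φ = 0 := by
  rw [spectralFunctional, cfc_congr (g := fun _ => 0)
    (fun t ht => h t (mem_spectrum_real_iff.1 ht)), cfc_const_zero]
  simp

end SpectralFunctional

/-! ### The lattice operator, its translates and its truncations -/

section Lattice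

open Polynomial

/-- The canonical basis vector of `ℓ²(ℤ)` at the site `i`. -/
def delta (i : ℤ) : L2Z := lp.single 2 i (1 : ℂ)

theorem delta_apply (i j : ℤ) : delta i j = if j = i then 1 else 0 := by
  rw [delta, lp.single_apply, Pi.single_apply]

theorem norm_delta (i : ℤ) : ‖delta i‖ = 1 := by
  rw [delta, lp.norm_single (by norm_num), norm_one]

theorem inner_delta (i : ℤ) (u : L2Z) : inner ℂ (delta i) u = u i := by
  rw [delta, lp.inner_single_left]
  simp

theorem dense_span_delta : Dense (Submodule.span ℂ (Set.range delta) : Set L2Z) := by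
  intro u
  refine mem_closure_of_tendsto (lp.hasSum_single (by norm_num) u) (Eventually.of_forall fun s => ?_)
  refine Submodule.sum_mem _ fun i _ => ?_
  have : lp.single 2 i (u i) = (u i) • delta i := by
    rw [delta, ← lp.single_smul, smul_eq_mul, mul_one]
  rw [this]
  exact Submodule.smul_mem _ _ (Submodule.subset_span ⟨i, rfl⟩)

theorem shift_apply (k : ℤ) (u : L2Z) (n : ℤ) : shift k u n = u (n + k) := rfl

theorem mulOp_apply (V : ℤ →ᵇ ℂ) (u : L2Z) (n : ℤ) : mulOp V u n = V n * u n := rfl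

theorem inner_shift (k : ℤ) (u w : L2Z) : inner ℂ (shift k u) w = inner ℂ u (shift (-k) w) := by
  rw [lp.inner_eq_tsum, lp.inner_eq_tsum,
    ← (Equiv.addRight k).tsum_eq fun n : ℤ => inner ℂ (u n) (shift (-k) w n)]
  refine tsum_congr fun n => ?_
  simp [shift_apply]

theorem inner_mulOp {V : ℤ →ᵇ ℂ} (hV : ∀ n, conj (V n) = V n) (u w : L2Z) :
    inner ℂ (mulOp V u) w = inner ℂ u (mulOp V w) := by
  rw [lp.inner_eq_tsum, lp.inner_eq_tsum]
  refine tsum_congr fun n => ?_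
  rw [mulOp_apply, mulOp_apply, RCLike.inner_apply, RCLike.inner_apply, map_mul, hV]
  ring

theorem opL2_zero_apply (V : ℤ →ᵇ ℂ) (u : L2Z) (n : ℤ) :
    opL2 0 V u n = V n * u n - u (n + 1) - u (n - 1) := by
  rw [opL2_apply]
  simp
  ring

theorem opL2_zero_eq (V : ℤ →ᵇ ℂ) (u : L2Z) :
    opL2 0 V u = mulOp V u - shift 1 u - shift (-1) u := by
  ext n
  rw [opL2_zero_apply]
  rfl

theorem isSelfAdjoint_opL2 {V : ℤ →ᵇ ℂ} (hV : ∀ n, conj (V n) = V n) :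
    IsSelfAdjoint (opL2 0 V) := by
  rw [ContinuousLinearMap.isSelfAdjoint_iff_isSymmetric]
  intro u w
  simp only [ContinuousLinearMap.coe_coe, opL2_zero_eq, inner_sub_left, inner_sub_right,
    inner_mulOp hV, inner_shift, neg_neg]
  ring

theorem norm_opL2_le (V : ℤ →ᵇ ℂ) : ‖opL2 0 V‖ ≤ ‖V‖ + 2 := by
  refine ContinuousLinearMap.opNorm_le_bound _ (by positivity) fun u => ?_
  rw [opL2_zero_eq]
  have h1 := norm_sub_le (mulOp V u - shift 1 u) (shift (-1) u)
  have h2 := norm_sub_le (mulOp V u) (shift 1 u)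
  have h3 : ‖mulOp V u‖ ≤ ‖V‖ * ‖u‖ :=
    LinearMap.mkContinuous_norm_le _ (norm_nonneg V) _ |> fun h =>
      (ContinuousLinearMap.le_opNorm _ u).trans (mul_le_mul_of_nonneg_right h (norm_nonneg u))
  rw [LinearIsometry.norm_map] at h1 h2
  linarith

/-- Translating the potential conjugates the operator by a translation. -/
theorem aeval_opL2_shift {V W : ℤ →ᵇ ℂ} {k : ℤ} (h : ∀ n, W n = V (n - k)) (q : ℂ[X]) (u : L2Z) :
    aeval (opL2 0 V) q (shift k u) = shift k (aeval (opL2 0 W) q u) := by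
  have h0 : ∀ u : L2Z, opL2 0 V (shift k u) = shift k (opL2 0 W u) := by
    intro u
    ext n
    simp only [shift_apply, opL2_zero_apply, h]
    rw [add_sub_cancel_right, add_right_comm n 1 k, sub_add_eq_add_sub n 1 k]
  induction q using Polynomial.induction_on' generalizing u with
  | add p q hp hq => simp only [map_add, add_apply, hp, hq]
  | monomial m a =>
    have : ∀ u : L2Z, (opL2 0 V ^ m) (shift k u) = shift k ((opL2 0 W ^ m) u) := by
      induction m with
      | zero => intro u; simp
      | succ m ih =>
        intro u
        rw [pow_succ, pow_succ, mul_apply_eq_comp, mul_apply_eq_comp, h0, ih]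
    simp only [aeval_monomial, mul_apply_eq_comp, this]
    simp [Algebra.algebraMap_eq_smul_one]

theorem shift_delta (i : ℤ) : shift (-i) (delta 0) = delta i := by
  ext n
  rw [shift_apply, delta_apply, delta_apply]
  congr 1
  exact propext ⟨fun h => by omega, fun h => by omega⟩

/-- Covariance: `δ_i` is a translate of `δ_0`, and translations move the potential along. This turns
sums over sites into sums along an orbit. -/
theorem aeval_opL2_delta {V W : ℤ →ᵇ ℂ} {i : ℤ} (h : ∀ n, W n = V (n + i)) (q : ℂ[X]) :
    aeval (opL2 0 V) q (delta i) i = aeval (opL2 0 W) q (delta 0) 0 := by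
  rw [← shift_delta, aeval_opL2_shift (W := W) (fun n => by rw [h, sub_neg_eq_add]), shift_apply,
    add_neg_cancel]

/-- Coordinates of `q(H) u` depend on the potential through sums and products. -/
theorem aeval_opL2_apply_induction {X : Type*} {V : X → ℤ →ᵇ ℂ} {P : (X → ℂ) → Prop}
    (hconst : ∀ c, P fun _ => c) (hadd : ∀ f h, P f → P h → P fun x => f x + h x)
    (hmul : ∀ f h, P f → P h → P fun x => f x * h x) (hV : ∀ n, P fun x => V x n)
    (q : ℂ[X]) (u : L2Z) (n : ℤ) : P fun x => aeval (opL2 0 (V x)) q u n := by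
  induction q using Polynomial.induction_on' with
  | add p q hp hq =>
    simp only [map_add, add_apply]
    exact hadd _ _ hp hq
  | monomial m a =>
    have key : ∀ n, P fun x => ((opL2 0 (V x)) ^ m) u n := by
      induction m with
      | zero => exact fun n => by simpa using hconst (u n)
      | succ m ih =>
        intro n
        have h1 := hadd _ _ (hadd _ _ (hmul _ _ (hV n) (ih n)) (hmul _ _ (hconst (-1)) (ih (n + 1))))
          (hmul _ _ (hconst (-1)) (ih (n - 1)))
        convert h1 using 2 with x
        rw [pow_succ', mul_apply_eq_comp, opL2_zero_apply]
        ring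
    have h1 := hmul _ _ (hconst a) (key n)
    convert h1 using 2 with x
    simp [aeval_monomial, Algebra.algebraMap_eq_smul_one]

/-- Gershgorin: the eigenvalue lies in a disc about some diagonal entry, whose modulus plus the
radius is the absolute row sum. -/
theorem norm_le_of_mem_spectrum_matrix {n : Type*} [Fintype n] [DecidableEq n] (M : Matrix n n ℂ)
    {R : ℝ} (hR : ∀ i, ∑ j, ‖M i j‖ ≤ R) {z : ℂ} (hz : z ∈ spectrum ℂ M) : ‖z‖ ≤ R := by
  rw [← Matrix.spectrum_toLin', ← Module.End.hasEigenvalue_iff_mem_spectrum] at hz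
  obtain ⟨i, hi⟩ := eigenvalue_mem_ball hz
  rw [Metric.mem_closedBall, dist_eq_norm] at hi
  have h1 := norm_add_le (z - M i i) (M i i)
  rw [sub_add_cancel] at h1
  have h2 := hR i
  rw [← Finset.sum_erase_add _ _ (Finset.mem_univ i)] at h2
  linarith

/-- The Dirichlet truncation of `opL2 0 V` to `{0, …, n-1}`. -/
def dirichlet (V : ℤ → ℂ) (n : ℕ) : Matrix (Fin n) (Fin n) ℂ :=
  Matrix.of fun i j =>
    if (j : ℕ) = i + 1 then -1 else if (i : ℕ) = j + 1 then -1
      else if i = j then V (i : ℕ) else 0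

/-- A row has at most three nonzero entries. The general `F` serves both the absolute row sums and
the matrix-vector product. -/
theorem dirichlet_sum (V : ℤ → ℂ) {n : ℕ} (i : Fin n) {M : Type*} [AddCommMonoid M] (F : ℂ → ℤ → M)
    (hF : ∀ k, F 0 k = 0) :
    ∑ j, F (dirichlet V n i j) ((j : ℕ) : ℤ)
      = F (V (i : ℕ)) ((i : ℕ) : ℤ) + (if (i : ℕ) + 1 < n then F (-1) ((i : ℕ) + 1) else 0)
        + (if 1 ≤ (i : ℕ) then F (-1) ((i : ℕ) - 1) else 0) := by
  have h1 : ∀ j : Fin n, F (dirichlet V n i j) ((j : ℕ) : ℤ)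
      = (if (j : ℕ) = i then F (V (i : ℕ)) ((j : ℕ) : ℤ) else 0)
        + (if (j : ℕ) = i + 1 then F (-1) ((j : ℕ) : ℤ) else 0)
        + (if 1 ≤ (i : ℕ) then if (j : ℕ) = i - 1 then F (-1) ((j : ℕ) : ℤ) else 0 else 0) := by
    intro j
    simp only [dirichlet, Matrix.of_apply, Fin.ext_iff]
    split_ifs <;> first | omega | simp [hF]
  simp_rw [h1]
  rw [Finset.sum_add_distrib, Finset.sum_add_distrib]
  rw [Fin.sum_univ_eq_sum_range (fun j => if j = (i : ℕ) then F (V (i : ℕ)) (j : ℤ) else 0) n,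
    Fin.sum_univ_eq_sum_range (fun j => if j = (i : ℕ) + 1 then F (-1) (j : ℤ) else 0) n,
    Fin.sum_univ_eq_sum_range (fun j => if 1 ≤ (i : ℕ) then if j = (i : ℕ) - 1 then F (-1) (j : ℤ)
      else 0 else 0) n]
  have hi := i.2
  congr 1
  · congr 1
    · simp
    · simp
  · split_ifs with h
    · rw [Finset.sum_ite_eq', if_pos (Finset.mem_range.2 (by omega))]
      push_cast [h]
      rfl
    · simp

theorem dirichlet_row_sum_le {V : ℤ → ℂ} {C : ℝ} (hC : ∀ n, ‖V n‖ ≤ C) {n : ℕ} (i : Fin n) :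
    ∑ j, ‖dirichlet V n i j‖ ≤ C + 2 := by
  rw [dirichlet_sum V i (fun z _ => ‖z‖) (by simp)]
  have := hC (i : ℕ)
  split_ifs <;> norm_num <;> linarith

theorem isHermitian_dirichlet {V : ℤ → ℂ} (hV : ∀ n, conj (V n) = V n) (n : ℕ) :
    (dirichlet V n).IsHermitian := by
  ext i j
  simp only [dirichlet, Matrix.conjTranspose_apply, Matrix.of_apply, Fin.ext_iff]
  split_ifs <;> first | omega | (simp; done) | (rw [← starRingEnd_apply, hV]; congr)

/-- The restriction of a sequence to `{0, …, n-1}`. -/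
def restrictFin (n : ℕ) (u : ℤ → ℂ) : Fin n → ℂ := fun i => u (i : ℕ)

/-- The neighbours dropped by the truncation lie outside the box, where `u` vanishes. -/
theorem dirichlet_mulVec (V : ℤ →ᵇ ℂ) {n : ℕ} (u : L2Z)
    (hu : ∀ k : ℤ, u k ≠ 0 → 0 ≤ k ∧ k < n) :
    (dirichlet V n).mulVec (restrictFin n u) = restrictFin n (opL2 0 V u) := by
  ext i
  have h1 := dirichlet_sum V i (fun z k => z * u k) (by simp)
  simp only [Matrix.mulVec, dotProduct, restrictFin]
  rw [h1, opL2_zero_apply]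
  have e1 : ¬ (i : ℕ) + 1 < n → u ((i : ℕ) + 1) = 0 := fun h => by
    by_contra h0
    have := (hu _ h0).2
    omega
  have e2 : ¬ 1 ≤ (i : ℕ) → u ((i : ℕ) - 1) = 0 := fun h => by
    by_contra h0
    have := (hu _ h0).1
    omega
  split_ifs with h2 h3 h3
  · ring
  · rw [e2 h3]; ring
  · rw [e1 h2]; ring
  · rw [e1 h2, e2 h3]; ring

/-- Finite propagation: each application of the operator reaches one site further. -/
theorem opL2_pow_delta_support (V : ℤ →ᵇ ℂ) (i : ℤ) (m : ℕ) (k : ℤ)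
    (h : (opL2 0 V ^ m) (delta i) k ≠ 0) : i - m ≤ k ∧ k ≤ i + m := by
  induction m generalizing k with
  | zero =>
    simp only [pow_zero, one_apply_eq_self, delta_apply] at h
    simp_all
  | succ m ih =>
    rw [pow_succ', mul_apply_eq_comp, opL2_zero_apply] at h
    by_contra hk
    push_cast at hk
    refine h ?_
    have h0 : ∀ l : ℤ, ¬ (i - m ≤ l ∧ l ≤ i + m) → (opL2 0 V ^ m) (delta i) l = 0 := fun l hl => by
      by_contra h'
      exact hl (ih l h')
    rw [h0 k (by omega), h0 (k + 1) (by omega), h0 (k - 1) (by omega)]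
    simp

/-- Only the vectors to which the operator is applied must live in the box; the last image may leave
it. Hence `i + m ≤ n` suffices. -/
theorem dirichlet_pow_mulVec (V : ℤ →ᵇ ℂ) {n : ℕ} (i : ℤ) (m : ℕ) (h1 : m ≤ i) (h2 : i + m ≤ n) :
    (dirichlet V n ^ m).mulVec (restrictFin n (delta i))
      = restrictFin n ((opL2 0 V ^ m) (delta i)) := by
  induction m with
  | zero => simp
  | succ m ih =>
    rw [pow_succ', ← Matrix.mulVec_mulVec, ih (by push_cast at h1; omega) (by push_cast at h2; omega),
      dirichlet_mulVec, ← mul_apply_eq_comp, ← pow_succ']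
    intro k hk
    have := opL2_pow_delta_support V i m k hk
    push_cast at h1 h2
    omega

theorem dirichlet_pow_diag (V : ℤ →ᵇ ℂ) {n : ℕ} (i : Fin n) (m : ℕ) (h1 : m ≤ (i : ℕ))
    (h2 : i + m ≤ n) :
    (dirichlet V n ^ m) i i = (opL2 0 V ^ m) (delta (i : ℕ)) (i : ℕ) := by
  have h := congr_fun (dirichlet_pow_mulVec V (n := n) (i : ℕ) m (by exact_mod_cast h1)
    (by exact_mod_cast h2)) i
  have h3 : restrictFin n (delta (i : ℕ)) = Pi.single i 1 := by
    ext j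
    simp only [restrictFin, delta_apply, Pi.single_apply, Fin.ext_iff, Nat.cast_inj]
  rw [h3, Matrix.mulVec_single_one] at h
  exact h

theorem norm_pow_apply_le {n : Type*} [Fintype n] [DecidableEq n] (M : Matrix n n ℂ)
    {R : ℝ} (hR : ∀ i, ∑ j, ‖M i j‖ ≤ R) (m : ℕ) (i j : n) : ‖(M ^ m) i j‖ ≤ R ^ m := by
  have hR0 : 0 ≤ R := (Finset.sum_nonneg fun _ _ => norm_nonneg _).trans (hR i)
  induction m generalizing i with
  | zero =>
    rw [pow_zero, pow_zero, Matrix.one_apply]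
    split_ifs <;> simp
  | succ m ih =>
    rw [pow_succ', Matrix.mul_apply]
    calc ‖∑ k, M i k * (M ^ m) k j‖ ≤ ∑ k, ‖M i k‖ * R ^ m :=
          norm_sum_le_of_le _ fun k _ => by
            rw [norm_mul]
            exact mul_le_mul_of_nonneg_left (ih k) (norm_nonneg _)
      _ ≤ R ^ (m + 1) := by
          rw [← Finset.sum_mul, pow_succ']
          exact mul_le_mul_of_nonneg_right (hR i) (by positivity)

theorem norm_opL2_pow_delta_le (V : ℤ →ᵇ ℂ) (m : ℕ) (i j : ℤ) :
    ‖(opL2 0 V ^ m) (delta i) j‖ ≤ (‖V‖ + 2) ^ m := by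
  calc ‖(opL2 0 V ^ m) (delta i) j‖ ≤ ‖(opL2 0 V ^ m) (delta i)‖ :=
        lp.norm_apply_le_norm (by norm_num) _ _
    _ ≤ ‖opL2 0 V ^ m‖ * ‖delta i‖ := ContinuousLinearMap.le_opNorm _ _
    _ ≤ (‖V‖ + 2) ^ m := by
        rw [norm_delta, mul_one]
        have h1 : ‖(1 : L2Z →L[ℂ] L2Z)‖ ≤ 1 := ContinuousLinearMap.norm_id_le
        rcases m with _ | m
        · simpa using h1
        · exact (norm_pow_le' _ m.succ_pos).trans
            (pow_le_pow_left₀ (norm_nonneg _) (norm_opL2_le V) _)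

/-- The trace of a polynomial of the truncation differs from the sum of the diagonal entries of the
polynomial of the operator by a boundary term. -/
theorem exists_trace_sub_le (R : ℝ) (q : ℂ[X]) :
    ∃ C : ℝ, ∀ V : ℤ →ᵇ ℂ, ‖V‖ + 2 ≤ R → ∀ n : ℕ,
      ‖(aeval (dirichlet V n) q).trace
        - ∑ i ∈ Finset.range n, aeval (opL2 0 V) q (delta (i : ℕ)) (i : ℕ)‖ ≤ C := by
  induction q using Polynomial.induction_on' with
  | add p q hp hq =>
    obtain ⟨C, hC⟩ := hp
    obtain ⟨D, hD⟩ := hq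
    refine ⟨C + D, fun V hV n => ?_⟩
    have h1 : (aeval (dirichlet V n) (p + q)).trace
        - ∑ i ∈ Finset.range n, aeval (opL2 0 V) (p + q) (delta (i : ℕ)) (i : ℕ)
        = ((aeval (dirichlet V n) p).trace
            - ∑ i ∈ Finset.range n, aeval (opL2 0 V) p (delta (i : ℕ)) (i : ℕ))
          + ((aeval (dirichlet V n) q).trace
            - ∑ i ∈ Finset.range n, aeval (opL2 0 V) q (delta (i : ℕ)) (i : ℕ)) := by
      simp only [map_add, Matrix.trace_add, add_apply, lp.coeFn_add, Pi.add_apply,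
        Finset.sum_add_distrib]
      ring
    rw [h1]
    exact (norm_add_le _ _).trans (add_le_add (hC V hV n) (hD V hV n))
  | monomial m a =>
    -- At most `2 m` sites lie within `m` of an end of the box. At each of them both diagonal
    -- entries are at most `R ^ m`; at the others the entries agree.
    refine ⟨‖a‖ * ((2 * m) * (2 * R ^ m)), fun V hV n => ?_⟩
    have h1 : (aeval (dirichlet V n) (monomial m a)).trace
        - ∑ i ∈ Finset.range n, aeval (opL2 0 V) (monomial m a) (delta (i : ℕ)) (i : ℕ)
        = a * ∑ i : Fin n, ((dirichlet V n ^ m) i i - (opL2 0 V ^ m) (delta (i : ℕ)) (i : ℕ)) := by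
      rw [Finset.sum_sub_distrib, mul_sub, ← Fin.sum_univ_eq_sum_range
        (fun i => aeval (opL2 0 V) (monomial m a) (delta (i : ℕ)) (i : ℕ)) n, Finset.mul_sum,
        Finset.mul_sum]
      simp [aeval_monomial, Algebra.algebraMap_eq_smul_one, Matrix.trace]
    have hR : 0 ≤ R := le_trans (by positivity) hV
    rw [h1, norm_mul]
    refine mul_le_mul_of_nonneg_left ?_ (norm_nonneg a)
    have h2 : ∀ i : Fin n, ‖(dirichlet V n ^ m) i i - (opL2 0 V ^ m) (delta (i : ℕ)) (i : ℕ)‖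
        ≤ if (i : ℕ) ∈ Finset.range m ∪ Finset.Ico (n - m) n then 2 * R ^ m else 0 := by
      intro i
      have hp : (‖V‖ + 2) ^ m ≤ R ^ m := pow_le_pow_left₀ (by positivity) hV m
      split_ifs with h
      · have h3 := norm_pow_apply_le (dirichlet V n)
          (dirichlet_row_sum_le fun n => V.norm_coe_le_norm n) m i i
        have h4 := norm_opL2_pow_delta_le V m (i : ℕ) (i : ℕ)
        exact (norm_sub_le _ _).trans (by linarith)
      · simp only [Finset.mem_union, Finset.mem_range, Finset.mem_Ico, not_or, not_and] at h
        have := i.2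
        rw [dirichlet_pow_diag V i m (by omega) (by omega), sub_self, norm_zero]
    refine (norm_sum_le_of_le _ fun i _ => h2 i).trans ?_
    rw [Fin.sum_univ_eq_sum_range (fun i => if i ∈ Finset.range m ∪ Finset.Ico (n - m) n
      then 2 * R ^ m else 0) n, ← Finset.sum_filter, Finset.sum_const, nsmul_eq_mul]
    refine mul_le_mul_of_nonneg_right ?_ (by positivity)
    have h3 : (Finset.filter (fun i => i ∈ Finset.range m ∪ Finset.Ico (n - m) n)
        (Finset.range n)).card ≤ m + m := by
      refine (Finset.card_le_card (t := Finset.range m ∪ Finset.Ico (n - m) n)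
        fun i hi => (Finset.mem_filter.1 hi).2).trans ((Finset.card_union_le _ _).trans ?_)
      rw [Finset.card_range, Nat.card_Ico]
      omega
    calc _ ≤ ((m + m : ℕ) : ℝ) := by exact_mod_cast h3
      _ = 2 * m := by push_cast; ring

end Lattice

/-! ### Eigenvalue averages of the truncations -/

section Eigenvalues

open Polynomial

theorem trace_aeval_of_isHermitian {n : Type*} [Fintype n] [DecidableEq n] {M : Matrix n n ℂ}
    (hM : M.IsHermitian) (q : ℂ[X]) :
    (aeval M q).trace = ∑ i, q.eval (hM.eigenvalues i : ℂ) := by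
  have h1 : aeval M q = Unitary.conjStarAlgAut ℂ (Matrix n n ℂ) hM.eigenvectorUnitary
      (Matrix.diagonal fun i => q.eval (hM.eigenvalues i : ℂ)) := by
    conv_lhs => rw [hM.spectral_theorem]
    rw [← StarAlgEquiv.coe_toAlgEquiv, aeval_algHom_apply]
    congr 1
    have h2 := aeval_algHom_apply (Matrix.diagonalAlgHom ℂ)
      (RCLike.ofReal ∘ hM.eigenvalues : n → ℂ) q
    rw [aeval_pi_apply] at h2
    exact h2
  rw [h1, Unitary.conjStarAlgAut_apply, Matrix.trace_mul_cycle]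
  simp [Matrix.trace]

theorem sum_roots_of_isHermitian {n : Type*} [Fintype n] [DecidableEq n] {M : Matrix n n ℂ}
    (hM : M.IsHermitian) (f : ℂ → ℝ) :
    (M.charpoly.roots.map f).sum = ∑ i, f (hM.eigenvalues i) := by
  rw [hM.roots_charpoly_eq_eigenvalues, Multiset.map_map]
  rfl

theorem integral_sum_map_dirac (s : Multiset ℂ) (f : ℂ → ℝ) :
    Integrable f (s.map fun z => Measure.dirac z).sum ∧
      ∫ z, f z ∂(s.map fun z => Measure.dirac z).sum = (s.map f).sum := by
  induction s using Multiset.induction_on with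
  | empty => simp
  | cons a s ih =>
    have h1 : Integrable f (Measure.dirac a) := integrable_dirac (by simp)
    rw [Multiset.map_cons, Multiset.sum_cons, Multiset.map_cons, Multiset.sum_cons]
    exact ⟨h1.add_measure ih.1, by rw [integral_add_measure h1 ih.1, ih.2, integral_dirac]⟩

theorem integral_countingMeasure {n : ℕ} (M : Matrix (Fin n) (Fin n) ℂ) (f : ℂ → ℝ) :
    ∫ z, f z ∂(countingMeasure M) = (n : ℝ)⁻¹ * (M.charpoly.roots.map f).sum := by
  rw [countingMeasure, integral_smul_measure, (integral_sum_map_dirac _ f).2]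
  simp

/-- The truncations for different `g` are conjugate by a diagonal matrix. -/
theorem charpoly_truncation {X : Type*} (T : X ≃ X) (v : X → ℝ) (g : ℝ) (x : X) (n : ℕ) :
    (truncation T v g x n).charpoly
      = (dirichlet (fun k => ((v (orbit T k x) : ℝ) : ℂ)) n).charpoly := by
  -- Conjugation multiplies the entry `(i, j)` by `e^{(i-j)g}`, which turns both off-diagonals into
  -- `-1`.
  let d : Fin n → ℂ := fun i => Complex.exp ((i : ℕ) * g)
  let d' : Fin n → ℂ := fun i => Complex.exp (-((i : ℕ) * g))
  have hd : ∀ i, d i * d' i = 1 := fun i => by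
    simp only [d, d']
    rw [← Complex.exp_add, add_neg_cancel, Complex.exp_zero]
  let U : (Matrix (Fin n) (Fin n) ℂ)ˣ :=
    ⟨Matrix.diagonal d, Matrix.diagonal d', by simp [Matrix.diagonal_mul_diagonal, hd],
      by simp [Matrix.diagonal_mul_diagonal, mul_comm, hd]⟩
  have h : U.val * truncation T v g x n * U⁻¹.val
      = dirichlet (fun k => ((v (orbit T k x) : ℝ) : ℂ)) n := by
    ext i j
    change (Matrix.diagonal d * truncation T v g x n * Matrix.diagonal d') i j = _
    rw [Matrix.mul_diagonal, Matrix.diagonal_mul]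
    simp only [truncation, dirichlet, Matrix.of_apply]
    split_ifs with h1 h2 h3
    · simp only [d, d', h1, mul_neg, neg_mul, Complex.ofReal_exp]
      rw [← Complex.exp_add, ← Complex.exp_add, neg_inj, Complex.exp_eq_one_iff]
      exact ⟨0, by push_cast; ring⟩
    · simp only [d, d', h2, mul_neg, neg_mul, Complex.ofReal_exp]
      rw [← Complex.exp_add, ← Complex.exp_add, neg_inj, Complex.exp_eq_one_iff]
      exact ⟨0, by push_cast; ring⟩
    · rw [← h3, mul_right_comm, hd, one_mul]
    · simp
  rw [← h, Matrix.coe_units_inv, Matrix.charpoly_units_conj]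

/-- The normalized sum of `φ` over the eigenvalues of the truncation. -/
def eigenAverage (V : ℤ → ℂ) (n : ℕ) (φ : ℝ → ℝ) : ℝ :=
  (n : ℝ)⁻¹ * ((dirichlet V n).charpoly.roots.map fun z => φ z.re).sum

theorem eigenAverage_eq {V : ℤ → ℂ} (hV : ∀ n, conj (V n) = V n) (n : ℕ) (φ : ℝ → ℝ) :
    eigenAverage V n φ = (n : ℝ)⁻¹ * ∑ i, φ ((isHermitian_dirichlet hV n).eigenvalues i) := by
  rw [eigenAverage, sum_roots_of_isHermitian (isHermitian_dirichlet hV n)]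
  simp only [Complex.ofReal_re]

theorem eigenvalues_dirichlet_mem {V : ℤ → ℂ} (hV : ∀ n, conj (V n) = V n) {C : ℝ}
    (hC : ∀ n, ‖V n‖ ≤ C) (n : ℕ) (i : Fin n) :
    (isHermitian_dirichlet hV n).eigenvalues i ∈ Set.Icc (-(C + 2)) (C + 2) := by
  rw [Set.mem_Icc, ← abs_le, ← Real.norm_eq_abs, ← Complex.norm_real]
  refine norm_le_of_mem_spectrum_matrix (dirichlet V n) (dirichlet_row_sum_le hC) ?_
  rw [(isHermitian_dirichlet hV n).spectrum_eq_image_range]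
  exact ⟨_, ⟨i, rfl⟩, rfl⟩

theorem abs_eigenAverage_sub_le {V : ℤ → ℂ} (hV : ∀ n, conj (V n) = V n) {C : ℝ}
    (hC : ∀ n, ‖V n‖ ≤ C) (n : ℕ) {φ ψ : ℝ → ℝ} {ε : ℝ} (hε : 0 ≤ ε)
    (h : ∀ t ∈ Set.Icc (-(C + 2)) (C + 2), |φ t - ψ t| ≤ ε) :
    |eigenAverage V n φ - eigenAverage V n ψ| ≤ ε := by
  rw [eigenAverage_eq hV, eigenAverage_eq hV, ← mul_sub, ← Finset.sum_sub_distrib, abs_mul]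
  have h1 : |∑ i, (φ ((isHermitian_dirichlet hV n).eigenvalues i)
      - ψ ((isHermitian_dirichlet hV n).eigenvalues i))| ≤ n * ε := by
    refine (Finset.abs_sum_le_sum_abs _ _).trans ((Finset.sum_le_card_nsmul _ _ ε
      fun i _ => h _ (eigenvalues_dirichlet_mem hV hC n i)).trans ?_)
    simp
  -- For `n = 0` both averages are `0`; this case is where `0 ≤ ε` is needed.
  rcases Nat.eq_zero_or_pos n with rfl | hn
  · simpa using hε
  · rw [abs_inv, Nat.abs_cast, inv_mul_le_iff₀ (by exact_mod_cast hn)]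
    exact h1

theorem eigenAverage_polynomial {V : ℤ → ℂ} (hV : ∀ n, conj (V n) = V n) (n : ℕ)
    (p : Polynomial ℝ) :
    eigenAverage V n (fun t => p.eval t)
      = (n : ℝ)⁻¹ * (aeval (dirichlet V n) (p.map (algebraMap ℝ ℂ))).trace.re := by
  rw [eigenAverage_eq hV, trace_aeval_of_isHermitian (isHermitian_dirichlet hV n), Complex.re_sum]
  congr 1
  refine Finset.sum_congr rfl fun i _ => ?_
  rw [← Complex.coe_algebraMap, eval_map_apply]
  simp

end Eigenvalues

/-! ### The density of states measure -/

section DensityOfStates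

open Polynomial

/-- A family of functionals is uniformly continuous for the supremum norm on `[-R, R]`. -/
def SupContractive (R : ℝ) (F : (ℝ → ℝ) → ℝ) : Prop :=
  ∀ ⦃φ ψ : ℝ → ℝ⦄ ⦃ε : ℝ⦄, Continuous φ → Continuous ψ → 0 ≤ ε →
    (∀ t ∈ Set.Icc (-R) R, |φ t - ψ t| ≤ ε) → |F φ - F ψ| ≤ ε

/-- A three-term estimate: a Weierstrass approximant within `ε / 4` on `[-R, R]` changes every `F n`
and `G` by at most `ε / 4`. -/
theorem tendsto_of_tendsto_polynomial {ι : Type*} {l : Filter ι} {F : ι → (ℝ → ℝ) → ℝ}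
    {G : (ℝ → ℝ) → ℝ} {R : ℝ} (hF : ∀ n, SupContractive R (F n)) (hG : SupContractive R G)
    (hp : ∀ p : ℝ[X], Tendsto (fun n => F n fun t => p.eval t) l (𝓝 (G fun t => p.eval t)))
    {φ : ℝ → ℝ} (hφ : Continuous φ) : Tendsto (fun n => F n φ) l (𝓝 (G φ)) := by
  refine Metric.tendsto_nhds.2 fun ε hε => ?_
  obtain ⟨p, h⟩ := exists_polynomial_near_of_continuousOn (-R) R φ hφ.continuousOn (ε / 4)
    (by linarith)
  have hc : Continuous fun t => p.eval t := p.continuous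
  filter_upwards [Metric.tendsto_nhds.1 (hp p) (ε / 4) (by linarith)] with n hn
  have h1 := hF n hc hφ (by linarith : 0 ≤ ε / 4) fun t ht => (h t ht).le
  have h2 := hG hc hφ (by linarith : 0 ≤ ε / 4) fun t ht => (h t ht).le
  rw [Real.dist_eq] at hn ⊢
  have h3 := abs_le.1 h1
  have h4 := abs_le.1 h2
  have h5 := abs_lt.1 hn
  exact abs_lt.2 ⟨by linarith, by linarith⟩

theorem orbit_orbit {X : Type*} (T : X ≃ X) (m n : ℤ) (x : X) : orbit T m (orbit T n x) = orbit T (m + n) x := by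
  rw [orbit, orbit, orbit, zpow_add, Equiv.Perm.mul_apply]

theorem orbit_natCast {X : Type*} (T : X ≃ X) (n : ℕ) (x : X) : orbit T n x = T^[n] x := by
  rw [orbit, zpow_natCast, Equiv.Perm.iterate_eq_pow]

theorem measurable_orbit {X : Type*} [MeasurableSpace X] (T : X ≃ᵐ X) (n : ℤ) : Measurable (orbit T.toEquiv n) := by
  obtain ⟨m, rfl | rfl⟩ := n.eq_nat_or_neg
  · have : orbit T.toEquiv m = T^[m] := funext fun x => orbit_natCast _ m x
    rw [this]
    exact T.measurable.iterate m
  · have : orbit T.toEquiv (-m) = T.symm^[m] := by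
      funext x
      rw [orbit, zpow_neg, zpow_natCast, ← inv_pow, ← Equiv.Perm.iterate_eq_pow]
      rfl
    rw [this]
    exact T.symm.measurable.iterate m

theorem measurePreserving_orbit {X : Type*} [MeasurableSpace X] {μ : Measure X}
    {T : X ≃ᵐ X} (hT : MeasurePreserving T μ μ) (n : ℤ) :
    MeasurePreserving (orbit T.toEquiv n) μ μ := by
  obtain ⟨m, rfl | rfl⟩ := n.eq_nat_or_neg
  · have : orbit T.toEquiv m = T^[m] := funext fun x => orbit_natCast _ m x
    rw [this]
    exact hT.iterate m
  · have : orbit T.toEquiv (-m) = T.symm^[m] := by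
      funext x
      rw [orbit, zpow_neg, zpow_natCast, ← inv_pow, ← Equiv.Perm.iterate_eq_pow]
      rfl
    rw [this]
    exact (hT.symm T).iterate m

variable {X : Type*} [TopologicalSpace X] [CompactSpace X]

theorem potential_apply (T : X ≃ X) (v : C(X, ℝ)) (x : X) (n : ℤ) :
    potential T v x n = ((v (orbit T n x) : ℝ) : ℂ) := rfl

theorem conj_potential (T : X ≃ X) (v : C(X, ℝ)) (x : X) (n : ℤ) :
    conj (potential T v x n) = potential T v x n := by
  rw [potential_apply, Complex.conj_ofReal]

theorem norm_potential_le (T : X ≃ X) (v : C(X, ℝ)) (x : X) : ‖potential T v x‖ ≤ ‖v‖ :=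
  BoundedContinuousFunction.norm_ofNormedAddCommGroup_le _ (norm_nonneg v) _

theorem potential_orbit (T : X ≃ X) (v : C(X, ℝ)) (x : X) (i n : ℤ) :
    potential T v (orbit T i x) n = potential T v x (n + i) := by
  rw [potential_apply, potential_apply, orbit_orbit]

/-- The Schrödinger operator `H(x)`. -/
def schrodinger (T : X ≃ X) (v : C(X, ℝ)) (x : X) : L2Z →L[ℂ] L2Z := opL2 0 (potential T v x)

theorem isSelfAdjoint_schrodinger (T : X ≃ X) (v : C(X, ℝ)) (x : X) :
    IsSelfAdjoint (schrodinger T v x) := isSelfAdjoint_opL2 (conj_potential T v x)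

theorem norm_schrodinger_le (T : X ≃ X) (v : C(X, ℝ)) (x : X) :
    ‖schrodinger T v x‖ ≤ ‖v‖ + 2 :=
  (norm_opL2_le _).trans (by linarith [norm_potential_le T v x])

/-- The spectral functional of `H(x)` at the site `i`. -/
def siteFunctional (T : X ≃ X) (v : C(X, ℝ)) (i : ℤ) (φ : ℝ → ℝ) (x : X) : ℝ :=
  spectralFunctional (schrodinger T v x) (delta i) φ

theorem supContractive_siteFunctional (T : X ≃ X) (v : C(X, ℝ)) (i : ℤ) (x : X) :
    SupContractive (‖v‖ + 2) fun φ => siteFunctional T v i φ x := by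
  intro φ ψ ε hφ hψ _ h
  exact abs_spectralFunctional_sub_le (isSelfAdjoint_schrodinger T v x) (norm_delta i) hφ hψ
    fun t ht => h t (abs_le_of_mem_spectrum (norm_schrodinger_le T v x) ht)

theorem siteFunctional_polynomial (T : X ≃ X) (v : C(X, ℝ)) (i : ℤ) (p : ℝ[X]) (x : X) :
    siteFunctional T v i (fun t => p.eval t) x
      = (aeval (opL2 0 (potential T v x)) (p.map (algebraMap ℝ ℂ)) (delta i) i).re := by
  rw [siteFunctional, spectralFunctional_polynomial (isSelfAdjoint_schrodinger T v x), inner_delta,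
    schrodinger]

theorem siteFunctional_polynomial_orbit (T : X ≃ X) (v : C(X, ℝ)) (i : ℤ) (p : ℝ[X]) (x : X) :
    siteFunctional T v i (fun t => p.eval t) x
      = siteFunctional T v 0 (fun t => p.eval t) (orbit T i x) := by
  rw [siteFunctional_polynomial, siteFunctional_polynomial,
    aeval_opL2_delta fun n => potential_orbit T v x i n]

theorem exists_abs_siteFunctional_le (T : X ≃ X) (v : C(X, ℝ)) {φ : ℝ → ℝ} (hφ : Continuous φ) :
    ∃ C, ∀ i x, |siteFunctional T v i φ x| ≤ C := by
  obtain ⟨C, hC⟩ := isCompact_Icc.exists_bound_of_continuousOn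
    (hφ.continuousOn (s := Set.Icc (-(‖v‖ + 2)) (‖v‖ + 2)))
  refine ⟨C, fun i x => ?_⟩
  have h0 : siteFunctional T v i (fun _ => 0) x = 0 :=
    spectralFunctional_eq_zero fun _ _ => rfl
  have h1 := supContractive_siteFunctional T v i x hφ continuous_const (ψ := fun _ => 0)
    ((norm_nonneg _).trans (hC 0 ⟨by linarith [norm_nonneg v], by linarith [norm_nonneg v]⟩))
    fun t ht => by simpa using hC t ht
  simpa only [h0, sub_zero] using h1

theorem continuous_siteFunctional_polynomial {T : X ≃ X} {v : C(X, ℝ)}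
    (h : ∀ n, Continuous (orbit T n)) (i : ℤ) (p : ℝ[X]) :
    Continuous (siteFunctional T v i fun t => p.eval t) := by
  have h1 := aeval_opL2_apply_induction (V := potential T v) (P := Continuous)
    (fun _ => continuous_const) (fun _ _ => Continuous.add) (fun _ _ => Continuous.mul)
    (fun n => Complex.continuous_ofReal.comp (v.continuous.comp (h n)))
    (p.map (algebraMap ℝ ℂ)) (delta i) i
  refine (Complex.continuous_re.comp h1).congr fun x => ?_
  rw [siteFunctional_polynomial]
  rfl

variable [MeasurableSpace X] [BorelSpace X]

/-- For polynomials the functional is a polynomial expression in values of `v` along the orbit;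
continuous `φ` follow as limits of these, by Weierstrass approximation. -/
theorem measurable_siteFunctional {T : X ≃ X} {v : C(X, ℝ)}
    (h : ∀ n, Measurable (orbit T n)) (i : ℤ) {φ : ℝ → ℝ} (hφ : Continuous φ) :
    Measurable (siteFunctional T v i φ) := by
  have hp : ∀ p : ℝ[X], Measurable (siteFunctional T v i fun t => p.eval t) := by
    intro p
    have h1 := aeval_opL2_apply_induction (V := potential T v) (P := Measurable)
      (fun _ => measurable_const) (fun _ _ => Measurable.add) (fun _ _ => Measurable.mul)
      (fun n => Complex.measurable_ofReal.comp (v.continuous.measurable.comp (h n)))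
      (p.map (algebraMap ℝ ℂ)) (delta i) i
    have h2 : (siteFunctional T v i fun t => p.eval t) = fun x =>
        (aeval (opL2 0 (potential T v x)) (p.map (algebraMap ℝ ℂ)) (delta i) i).re :=
      funext fun x => siteFunctional_polynomial T v i p x
    rw [h2]
    exact Complex.measurable_re.comp h1
  have hex : ∀ k : ℕ, ∃ p : ℝ[X], ∀ t ∈ Set.Icc (-(‖v‖ + 2)) (‖v‖ + 2),
      |p.eval t - φ t| < 1 / ((k : ℝ) + 1) := fun k =>
    exists_polynomial_near_of_continuousOn _ _ φ hφ.continuousOn _ (by positivity)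
  choose p hpk using hex
  refine measurable_of_tendsto_metrizable (fun k => hp (p k)) (tendsto_pi_nhds.2 fun x => ?_)
  rw [tendsto_iff_dist_tendsto_zero]
  refine squeeze_zero (fun _ => dist_nonneg) (fun k => ?_) tendsto_one_div_add_atTop_nhds_zero_nat
  rw [Real.dist_eq]
  exact supContractive_siteFunctional T v i x (p k).continuous hφ (by positivity)
    fun t ht => (hpk k t ht).le

variable {μ : Measure X} [IsProbabilityMeasure μ] {T : X ≃ᵐ X} {v : C(X, ℝ)}

theorem integrable_siteFunctional (i : ℤ) {φ : ℝ → ℝ} (hφ : Continuous φ) :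
    Integrable (siteFunctional T.toEquiv v i φ) μ := by
  obtain ⟨C, hC⟩ := exists_abs_siteFunctional_le T.toEquiv v hφ
  exact Integrable.of_bound
    (measurable_siteFunctional (measurable_orbit T) i hφ).aestronglyMeasurable C
    (ae_of_all _ fun x => hC i x)

variable (μ T v) in
/-- The density of states functional. -/
def dosFunctional (φ : ℝ → ℝ) : ℝ := ∫ x, siteFunctional T.toEquiv v 0 φ x ∂μ

theorem abs_integral_sub_le {f h : X → ℝ} (hf : Integrable f μ) (hh : Integrable h μ) {ε : ℝ}
    (hfh : ∀ x, |f x - h x| ≤ ε) : |∫ x, f x ∂μ - ∫ x, h x ∂μ| ≤ ε := by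
  rw [← integral_sub hf hh]
  simpa using norm_integral_le_of_norm_le_const (μ := μ) (ae_of_all _ fun x =>
    (Real.norm_eq_abs _).trans_le (hfh x))

theorem supContractive_dosFunctional : SupContractive (‖v‖ + 2) (dosFunctional μ T v) := by
  intro φ ψ ε hφ hψ hε h
  exact abs_integral_sub_le (integrable_siteFunctional 0 hφ) (integrable_siteFunctional 0 hψ)
    fun x => supContractive_siteFunctional T.toEquiv v 0 x hφ hψ hε h

theorem dosFunctional_add {φ ψ : ℝ → ℝ} (hφ : Continuous φ) (hψ : Continuous ψ) :
    dosFunctional μ T v (φ + ψ) = dosFunctional μ T v φ + dosFunctional μ T v ψ := by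
  rw [dosFunctional, dosFunctional, dosFunctional,
    ← integral_add (integrable_siteFunctional 0 hφ) (integrable_siteFunctional 0 hψ)]
  exact integral_congr_ae (ae_of_all _ fun x => spectralFunctional_add hφ hψ)

theorem dosFunctional_smul (c : ℝ) {φ : ℝ → ℝ} (hφ : Continuous φ) :
    dosFunctional μ T v (c • φ) = c * dosFunctional μ T v φ := by
  rw [dosFunctional, dosFunctional, ← integral_const_mul]
  exact integral_congr_ae (ae_of_all _ fun x => spectralFunctional_smul c hφ)

variable (μ T v) in
/-- The density of states measure on the real line. -/
theorem exists_densityOfStates : ∃ N : Measure ℝ, IsProbabilityMeasure N ∧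
    (∀ᵐ t ∂N, t ∈ Set.Icc (-(‖v‖ + 2)) (‖v‖ + 2)) ∧
    ∀ φ : ℝ → ℝ, Continuous φ → ∫ t, φ t ∂N = dosFunctional μ T v φ := by
  set R := ‖v‖ + 2 with hR
  have hRR : -R ≤ R := by linarith [norm_nonneg v]
  -- The spectra all lie in `[-R, R]`, so how a function is extended outside is immaterial; the
  -- constant extension is linear in `f` and continuous.
  have hext : ∀ f : C(Set.Icc (-R) R, ℝ), Continuous (Set.IccExtend hRR f) :=
    fun f => f.continuous.Icc_extend'
  obtain ⟨ν, -, hprob, hν⟩ := exists_regular_measure_of_functional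
    (fun f : C(Set.Icc (-R) R, ℝ) => dosFunctional μ T v (Set.IccExtend hRR f))
    (fun f h => dosFunctional_add (hext f) (hext h))
    (fun c f => dosFunctional_smul c (hext f))
    (fun f h hfh => integral_mono (integrable_siteFunctional 0 (hext f))
      (integrable_siteFunctional 0 (hext h)) fun x =>
        spectralFunctional_mono (isSelfAdjoint_schrodinger _ v x) (hext f) (hext h)
          fun t _ => hfh _)
    (by
      have : ∀ x, siteFunctional T.toEquiv v 0
          (Set.IccExtend hRR (1 : C(Set.Icc (-R) R, ℝ))) x = 1 := fun x =>
        spectralFunctional_one (isSelfAdjoint_schrodinger _ v x) (norm_delta 0)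
      exact (integral_congr_ae (ae_of_all _ this)).trans (by simp))
  refine ⟨ν.map Subtype.val,
    Measure.isProbabilityMeasure_map measurable_subtype_coe.aemeasurable, ?_, fun φ hφ => ?_⟩
  · exact (ae_map_iff measurable_subtype_coe.aemeasurable (measurableSet_Icc (a := -R) (b := R))).2
      (ae_of_all _ fun t => t.2)
  · rw [integral_map measurable_subtype_coe.aemeasurable hφ.aestronglyMeasurable]
    refine (hν ⟨fun t => φ t, hφ.comp continuous_subtype_val⟩).trans ?_
    refine integral_congr_ae (ae_of_all _ fun x => spectralFunctional_congr fun t ht => ?_)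
    exact Set.IccExtend_of_mem hRR _ (abs_le_of_mem_spectrum (norm_schrodinger_le _ v x) ht)

/-- The site functionals have the same mean at every site. -/
theorem integral_siteFunctional (hT : MeasurePreserving T μ μ) (i : ℤ) {φ : ℝ → ℝ}
    (hφ : Continuous φ) :
    ∫ x, siteFunctional T.toEquiv v i φ x ∂μ = dosFunctional μ T v φ := by
  have hc : SupContractive (‖v‖ + 2) fun φ => ∫ x, siteFunctional T.toEquiv v i φ x ∂μ := by
    intro φ ψ ε hφ hψ hε h
    exact abs_integral_sub_le (integrable_siteFunctional i hφ) (integrable_siteFunctional i hψ)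
      fun x => supContractive_siteFunctional T.toEquiv v i x hφ hψ hε h
  -- Applied to a constant sequence, the approximation lemma extends an identity from polynomials to
  -- continuous functions. For polynomials it is covariance plus invariance of `μ`.
  refine tendsto_nhds_unique (l := (atTop : Filter ℕ)) tendsto_const_nhds
    (tendsto_of_tendsto_polynomial (l := (atTop : Filter ℕ))
      (F := fun _ φ => ∫ x, siteFunctional T.toEquiv v i φ x ∂μ) (fun _ => hc)
      supContractive_dosFunctional (fun p => ?_) hφ)
  refine tendsto_const_nhds.congr fun _ => ?_
  simp_rw [siteFunctional_polynomial_orbit _ _ i]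
  have hm := (measurable_siteFunctional (v := v) (measurable_orbit T) 0 p.continuous)
  have hi := measurePreserving_orbit hT i
  have h1 := integral_map (μ := μ) hi.measurable.aemeasurable
    (f := siteFunctional T.toEquiv v 0 fun t => p.eval t) hm.aestronglyMeasurable
  rw [hi.map_eq] at h1
  exact h1

end DensityOfStates

/-! ### Generic points, convergence of averages, almost sure spectrum -/

section Generic

open Polynomial

variable {X : Type*} [TopologicalSpace X] [CompactSpace X]

/-- The average of the spectral functionals of `H(x)` over the sites `0, …, n-1`. -/
def siteAverage (T : X ≃ X) (v : C(X, ℝ)) (x : X) (n : ℕ) (φ : ℝ → ℝ) : ℝ :=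
  (n : ℝ)⁻¹ * ∑ i ∈ Finset.range n, siteFunctional T v i φ x

theorem supContractive_siteAverage (T : X ≃ X) (v : C(X, ℝ)) (x : X) (n : ℕ) :
    SupContractive (‖v‖ + 2) (siteAverage T v x n) := by
  intro φ ψ ε hφ hψ hε h
  rw [siteAverage, siteAverage, ← mul_sub, ← Finset.sum_sub_distrib, abs_mul]
  have h1 : |∑ i ∈ Finset.range n, (siteFunctional T v i φ x - siteFunctional T v i ψ x)|
      ≤ n * ε := by
    refine (Finset.abs_sum_le_sum_abs _ _).trans ((Finset.sum_le_card_nsmul (Finset.range n)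
      (fun i : ℕ => |siteFunctional T v i φ x - siteFunctional T v i ψ x|) ε
      fun i _ => supContractive_siteFunctional T v i x hφ hψ hε h).trans ?_)
    simp
  rcases Nat.eq_zero_or_pos n with rfl | hn
  · simpa using hε
  · rw [abs_inv, Nat.abs_cast, inv_mul_le_iff₀ (by exact_mod_cast hn)]
    exact h1

theorem siteAverage_eq_birkhoffAverage (T : X ≃ X) (v : C(X, ℝ)) (x : X) (n : ℕ) (p : ℝ[X]) :
    siteAverage T v x n (fun t => p.eval t)
      = birkhoffAverage ℝ T (siteFunctional T v 0 fun t => p.eval t) n x := by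
  rw [siteAverage, birkhoffAverage, birkhoffSum, smul_eq_mul]
  simp_rw [siteFunctional_polynomial_orbit T v (Nat.cast _), orbit_natCast]

/-- The boundary term of `exists_trace_sub_le` is bounded uniformly in `x` and `n`, so it is lost
after division by `n`. -/
theorem abs_eigenAverage_sub_siteAverage_le (T : X ≃ X) (v : C(X, ℝ)) (p : ℝ[X]) :
    ∃ C : ℝ, ∀ x n, |eigenAverage (potential T v x) n (fun t => p.eval t)
      - siteAverage T v x n (fun t => p.eval t)| ≤ C / n := by
  obtain ⟨C, hC⟩ := exists_trace_sub_le (‖v‖ + 2) (p.map (algebraMap ℝ ℂ))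
  refine ⟨C, fun x n => ?_⟩
  have h1 := hC (potential T v x) (by linarith [norm_potential_le T v x]) n
  have h2 := (Complex.abs_re_le_norm _).trans h1
  rw [Complex.sub_re, Complex.re_sum] at h2
  rw [eigenAverage_polynomial (conj_potential T v x), siteAverage, ← mul_sub, abs_mul, abs_inv,
    Nat.abs_cast, inv_mul_eq_div]
  simp_rw [siteFunctional_polynomial]
  gcongr

variable [MeasurableSpace X] [BorelSpace X] {μ : Measure X} [IsProbabilityMeasure μ]
  {T : X ≃ᵐ X} {v : C(X, ℝ)}

variable (μ T v) in
/-- The moments of the spectral functionals along the orbit of `x` converge to their means. -/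
def IsGeneric (x : X) : Prop :=
  ∀ k : ℕ, Tendsto (fun n => siteAverage T.toEquiv v x n fun t => (Polynomial.X ^ k : ℝ[X]).eval t) atTop
    (𝓝 (dosFunctional μ T v fun t => (Polynomial.X ^ k : ℝ[X]).eval t))

/-- Genericity involves countably many moments only, so Birkhoff's theorem for each of them leaves a
single null set. -/
theorem ae_isGeneric (hT : Ergodic T μ) : ∀ᵐ x ∂μ, IsGeneric μ T v x := by
  refine ae_all_iff.2 fun k => ?_
  obtain ⟨C, hC⟩ := exists_abs_siteFunctional_le T.toEquiv v (Polynomial.X ^ k : ℝ[X]).continuous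
  simp_rw [siteAverage_eq_birkhoffAverage]
  exact ae_tendsto_birkhoffAverage hT
    (measurable_siteFunctional (measurable_orbit T) 0 (Polynomial.X ^ k : ℝ[X]).continuous) (hC 0)

/-- A continuous bijection of a compact Hausdorff space is a homeomorphism. The moments, being
polynomial in `v ∘ T^n` with `n` of both signs, are therefore continuous in `x`. -/
theorem isGeneric_of_isUniquelyErgodic [T2Space X] (h : IsUniquelyErgodic T.toEquiv μ) (x : X) :
    IsGeneric μ T v x := by
  obtain ⟨hc, -, huniq⟩ := h
  let S : X ≃ₜ X := hc.homeoOfEquivCompactToT2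
  have horb : ∀ n, Continuous (orbit T.toEquiv n) := by
    intro n
    obtain ⟨m, rfl | rfl⟩ := n.eq_nat_or_neg
    · exact (hc.iterate m).congr fun x => (orbit_natCast _ m x).symm
    · refine (S.symm.continuous.iterate m).congr fun x => ?_
      rw [orbit, zpow_neg, zpow_natCast, ← inv_pow, ← Equiv.Perm.iterate_eq_pow]
      rfl
  intro k
  simp_rw [siteAverage_eq_birkhoffAverage]
  exact tendsto_birkhoffAverage_of_unique S huniq
    ⟨_, continuous_siteFunctional_polynomial (v := v) horb 0 (Polynomial.X ^ k)⟩ x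

theorem IsGeneric.tendsto_siteAverage {x : X} (hx : IsGeneric μ T v x) {φ : ℝ → ℝ}
    (hφ : Continuous φ) :
    Tendsto (fun n => siteAverage T.toEquiv v x n φ) atTop (𝓝 (dosFunctional μ T v φ)) := by
  refine tendsto_of_tendsto_polynomial (supContractive_siteAverage T.toEquiv v x)
    supContractive_dosFunctional (fun p => ?_) hφ
  induction p using Polynomial.induction_on' with
  | add p q hp hq =>
    have e : (fun t => (p + q).eval t) = (fun t => p.eval t) + fun t => q.eval t :=
      funext fun t => eval_add
    rw [e, dosFunctional_add p.continuous q.continuous]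
    refine (hp.add hq).congr fun n => ?_
    rw [siteAverage, siteAverage, siteAverage, ← mul_add, ← Finset.sum_add_distrib]
    congr 1
    exact Finset.sum_congr rfl fun i _ =>
      (spectralFunctional_add p.continuous q.continuous).symm
  | monomial k a =>
    have e : (fun t => (monomial k a).eval t) = a • fun t => (Polynomial.X ^ k : ℝ[X]).eval t :=
      funext fun t => by simp [eval_monomial]
    rw [e, dosFunctional_smul a (Polynomial.X ^ k : ℝ[X]).continuous]
    refine ((hx k).const_mul a).congr fun n => ?_
    rw [siteAverage, siteAverage, mul_left_comm, Finset.mul_sum]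
    congr 1
    exact Finset.sum_congr rfl fun i _ =>
      (spectralFunctional_smul a (Polynomial.X ^ k : ℝ[X]).continuous).symm

theorem IsGeneric.tendsto_eigenAverage {x : X} (hx : IsGeneric μ T v x) {φ : ℝ → ℝ}
    (hφ : Continuous φ) :
    Tendsto (fun n => eigenAverage (potential T.toEquiv v x) n φ) atTop
      (𝓝 (dosFunctional μ T v φ)) := by
  refine tendsto_of_tendsto_polynomial (F := fun n => eigenAverage (potential T.toEquiv v x) n)
    (fun n φ ψ ε _ _ hε h => abs_eigenAverage_sub_le (conj_potential T.toEquiv v x)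
      (C := ‖v‖) (fun k => ((potential T.toEquiv v x).norm_coe_le_norm k).trans
        (norm_potential_le _ _ _)) n hε h)
    supContractive_dosFunctional (fun p => ?_) hφ
  obtain ⟨C, hC⟩ := abs_eigenAverage_sub_siteAverage_le T.toEquiv v p
  have h1 : Tendsto (fun n => eigenAverage (potential T.toEquiv v x) n (fun t => p.eval t)
      - siteAverage T.toEquiv v x n (fun t => p.eval t)) atTop (𝓝 0) :=
    squeeze_zero_norm (hC x) (tendsto_const_div_atTop_nhds_zero_nat C)
  simpa using h1.add (hx.tendsto_siteAverage p.continuous)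

/-- The tent function with support `[p, q]`. -/
def tent (p q t : ℝ) : ℝ := max 0 (min (t - p) (q - t))

theorem continuous_tent (p q : ℝ) : Continuous (tent p q) := by
  unfold tent
  fun_prop

theorem tent_eq_zero_iff (p q t : ℝ) : tent p q t = 0 ↔ t ∉ Set.Ioo p q := by
  rw [tent, max_eq_left_iff, ← not_lt, lt_min_iff, sub_pos, sub_pos, Set.mem_Ioo]

theorem measure_Ioo_eq_zero_iff {N : Measure ℝ} [IsProbabilityMeasure N]
    (hN : ∀ φ : ℝ → ℝ, Continuous φ → ∫ t, φ t ∂N = dosFunctional μ T v φ) (p q : ℝ) :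
    N (Set.Ioo p q) = 0 ↔ dosFunctional μ T v (fun t => tent p q t ^ 2) = 0 := by
  have hc : Continuous fun t => tent p q t ^ 2 := (continuous_tent p q).pow 2
  have hi : Integrable (fun t => tent p q t ^ 2) N := by
    refine Integrable.of_bound hc.aestronglyMeasurable ((|p| + |q|) ^ 2) (ae_of_all _ fun t => ?_)
    rw [norm_pow]
    refine pow_le_pow_left₀ (norm_nonneg _) ?_ 2
    rw [Real.norm_eq_abs, abs_of_nonneg (le_max_left _ _), tent]
    refine max_le (by positivity) ?_
    rcases le_total t 0 with h | h
    · exact (min_le_left _ _).trans (by linarith [neg_abs_le p, abs_nonneg q])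
    · exact (min_le_right _ _).trans (by linarith [le_abs_self q, abs_nonneg p])
  rw [← hN _ hc, integral_eq_zero_iff_of_nonneg (fun _ => sq_nonneg _) hi, measure_eq_zero_iff_ae_notMem]
  refine eventually_congr (ae_of_all _ fun t => ?_)
  simp [tent_eq_zero_iff]

/-- At every site the functional of the squared tent is nonnegative with mean zero, hence zero
almost surely. Over the countably many sites this forces `tent(H(x)) = 0`. -/
theorem ae_tent_eq_zero (hT : MeasurePreserving T μ μ) {p q : ℝ}
    (h : dosFunctional μ T v (fun t => tent p q t ^ 2) = 0) :
    ∀ᵐ x ∂μ, ∀ t : ℝ, (t : ℂ) ∈ spectrum ℂ (schrodinger T.toEquiv v x) → tent p q t = 0 := by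
  have hc : Continuous fun t => tent p q t ^ 2 := (continuous_tent p q).pow 2
  have h1 : ∀ᵐ x ∂μ, ∀ i : ℤ, siteFunctional T.toEquiv v i (fun t => tent p q t ^ 2) x = 0 := by
    refine ae_all_iff.2 fun i => ?_
    have h2 : 0 ≤ siteFunctional T.toEquiv v i fun t => tent p q t ^ 2 := fun x =>
      spectralFunctional_nonneg (isSelfAdjoint_schrodinger _ v x) hc fun _ _ => sq_nonneg _
    exact (integral_eq_zero_iff_of_nonneg h2 (integrable_siteFunctional i hc)).1
      ((integral_siteFunctional hT i hc).trans h)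
  filter_upwards [h1] with x hx
  refine eq_zero_on_spectrum_of_spectralFunctional (isSelfAdjoint_schrodinger _ v x)
    (continuous_tent p q) dense_span_delta ?_
  rintro _ ⟨i, rfl⟩
  exact hx i

/-- All site averages at `x` are zero, and the density of states is their limit. -/
theorem IsGeneric.dosFunctional_eq_zero {x : X} (hx : IsGeneric μ T v x) {φ : ℝ → ℝ}
    (hφ : Continuous φ)
    (h : ∀ t : ℝ, (t : ℂ) ∈ spectrum ℂ (schrodinger T.toEquiv v x) → φ t = 0) :
    dosFunctional μ T v φ = 0 := by
  refine tendsto_nhds_unique (hx.tendsto_siteAverage hφ) (tendsto_const_nhds.congr fun n => ?_)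
  simp [siteAverage, siteFunctional, spectralFunctional_eq_zero h]

/-- Two closed sets coincide if the same intervals with rational endpoints avoid them. -/
theorem eq_of_forall_rat_disjoint {s t : Set ℝ} (hs : IsClosed s) (ht : IsClosed t)
    (h : ∀ p q : ℚ, (∀ y ∈ s, y ∉ Set.Ioo (p : ℝ) q) ↔ ∀ y ∈ t, y ∉ Set.Ioo (p : ℝ) q) :
    s = t := by
  have key : ∀ {s t : Set ℝ}, IsClosed t → (∀ p q : ℚ, (∀ y ∈ t, y ∉ Set.Ioo (p : ℝ) q) →
      ∀ y ∈ s, y ∉ Set.Ioo (p : ℝ) q) → s ⊆ t := by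
    intro s t ht h y hy
    by_contra hyt
    obtain ⟨a, b, hab, hsub⟩ := mem_nhds_iff_exists_Ioo_subset.1 (ht.isOpen_compl.mem_nhds hyt)
    obtain ⟨p, hp1, hp2⟩ := exists_rat_btwn hab.1
    obtain ⟨q, hq1, hq2⟩ := exists_rat_btwn hab.2
    exact h p q (fun z hz hzpq => hsub ⟨hp1.trans hzpq.1, hzpq.2.trans hq2⟩ hz) y hy ⟨hp2, hq1⟩
  exact (key ht fun p q => (h p q).2).antisymm (key hs fun p q => (h p q).1)

/-- Closed sets are determined by the rational intervals that miss them, and there are countably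
many of these. So the exceptional sets combine into one, and almost sure constancy of the spectrum
comes along with its identification. -/
theorem ae_real_spectrum_eq_support (hT : Ergodic T μ) {N : Measure ℝ} [IsProbabilityMeasure N]
    (hN : ∀ φ : ℝ → ℝ, Continuous φ → ∫ t, φ t ∂N = dosFunctional μ T v φ) :
    ∀ᵐ x ∂μ, {t : ℝ | (t : ℂ) ∈ spectrum ℂ (schrodinger T.toEquiv v x)} = N.support := by
  have h1 : ∀ᵐ x ∂μ, ∀ p q : ℚ, dosFunctional μ T v (fun t => tent p q t ^ 2) = 0 →
      ∀ t : ℝ, (t : ℂ) ∈ spectrum ℂ (schrodinger T.toEquiv v x) → tent p q t = 0 :=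
    ae_all_iff.2 fun p => ae_all_iff.2 fun q => by
      by_cases h : dosFunctional μ T v (fun t => tent p q t ^ 2) = 0
      · filter_upwards [ae_tent_eq_zero hT.toMeasurePreserving h] with x hx _ using hx
      · exact ae_of_all _ fun x h' => absurd h' h
  filter_upwards [h1, ae_isGeneric (v := v) hT] with x hx hgen
  refine eq_of_forall_rat_disjoint
    ((spectrum.isClosed (𝕜 := ℂ) _).preimage Complex.continuous_ofReal)
    Measure.isClosed_support fun p q => ?_
  have h2 : (∀ y ∈ N.support, y ∉ Set.Ioo (p : ℝ) q) ↔ N (Set.Ioo (p : ℝ) q) = 0 := by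
    constructor
    · intro h
      by_contra h0
      obtain ⟨y, hy1, hy2⟩ := Measure.nonempty_inter_support_of_pos (pos_iff_ne_zero.2 h0)
      exact h y hy2 hy1
    · intro h y hy hyI
      exact ((Measure.mem_support_iff_forall y).1 hy _ (isOpen_Ioo.mem_nhds hyI)).ne' h
  rw [h2, measure_Ioo_eq_zero_iff hN]
  constructor
  · intro h
    refine hgen.dosFunctional_eq_zero ((continuous_tent p q).pow 2) fun t ht => ?_
    rw [(tent_eq_zero_iff _ _ _).2 (h t ht), zero_pow two_ne_zero]
  · exact fun h t ht => (tent_eq_zero_iff _ _ _).1 (hx p q h t ht)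

/-- `Complex.ofReal` is a closed embedding: the complement of the real line is an open null set, and
neighbourhoods in `ℝ` are traces of neighbourhoods in `ℂ`. -/
theorem support_map_ofReal (N : Measure ℝ) :
    (N.map Complex.ofReal).support = Complex.ofReal '' N.support := by
  ext z
  rw [Measure.mem_support_iff_forall]
  have hm := Complex.measurable_ofReal
  constructor
  · intro h
    by_cases hz : z ∈ Set.range Complex.ofReal
    · obtain ⟨t, rfl⟩ := hz
      refine ⟨t, (Measure.mem_support_iff_forall t).2 fun U hU => ?_, rfl⟩
      obtain ⟨W, hW, hWU⟩ := Complex.isometry_ofReal.isUniformInducing.isInducing.nhds_eq_comap t ▸ hU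
      obtain ⟨O, hOW, hO, htO⟩ := mem_nhds_iff.1 hW
      have := h O (hO.mem_nhds htO)
      rw [Measure.map_apply hm hO.measurableSet] at this
      exact this.trans_le (measure_mono fun s hs => hWU (hOW hs))
    · have hcl : IsClosed (Set.range Complex.ofReal) :=
        Complex.isometry_ofReal.isClosedEmbedding.isClosed_range
      have := h _ (hcl.isOpen_compl.mem_nhds hz)
      rw [Measure.map_apply hm hcl.isOpen_compl.measurableSet] at this
      simp at this
  · rintro ⟨t, ht, rfl⟩ U hU
    obtain ⟨O, hOU, hO, htO⟩ := mem_nhds_iff.1 hU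
    refine lt_of_lt_of_le ?_ (measure_mono hOU)
    rw [Measure.map_apply hm hO.measurableSet]
    exact (Measure.mem_support_iff_forall t).1 ht _
      ((hO.preimage Complex.continuous_ofReal).mem_nhds htO)

end Generic

/-! ### Removing the weight -/

section Weighted

variable {g : ℝ}

theorem toL2_surjective : Function.Surjective (WeightedL2.toL2 (g := g)) := by
  intro u
  have h : ∀ n : ℤ, (Real.exp (n * g) : ℂ) * ((Real.exp (-(n * g)) : ℂ) * u n) = u n := by
    intro n
    rw [← mul_assoc, ← Complex.ofReal_mul, ← Real.exp_add, add_neg_cancel, Real.exp_zero,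
      Complex.ofReal_one, one_mul]
  refine ⟨⟨fun n => (Real.exp (-(n * g)) : ℂ) * u n, ?_⟩, ?_⟩
  · refine (L2Z_summable u).congr fun n => ?_
    rw [← WeightedL2.norm_weight_sq, h]
  · ext n
    exact h n

/-- The isometric isomorphism `(u_n) ↦ (e^{ng} u_n)` of `ℓ^{2,g}(ℤ)` onto `ℓ²(ℤ)`. -/
def weightedEquiv (g : ℝ) : WeightedL2 g ≃ₗᵢ[ℂ] L2Z where
  toLinearEquiv := LinearEquiv.ofBijective WeightedL2.toL2
    ⟨WeightedL2.toL2_injective, toL2_surjective⟩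
  norm_map' := WeightedL2.norm_toL2

/-- The weight map conjugates one operator into the other, by `weight_opFun`, and spectra are
invariant under algebra isomorphisms. -/
theorem spectrum_opWeighted (g : ℝ) (V : ℤ →ᵇ ℂ) :
    spectrum ℂ (opWeighted g V) = spectrum ℂ (opL2 0 V) := by
  have h : (weightedEquiv g).toContinuousLinearEquiv.conjContinuousAlgEquiv (opWeighted g V)
      = opL2 0 V := by
    ext u n
    obtain ⟨w, rfl⟩ := (weightedEquiv g).surjective u
    have h1 : (weightedEquiv g).toContinuousLinearEquiv.conjContinuousAlgEquiv (opWeighted g V)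
        (weightedEquiv g w) = weightedEquiv g (opWeighted g V w) := by
      simp
    rw [h1]
    exact WeightedL2.weight_opFun V w n
  rw [← h]
  exact (AlgEquiv.spectrum_eq
    (weightedEquiv g).toContinuousLinearEquiv.conjContinuousAlgEquiv _).symm

end Weighted

/-! ### Characteristic polynomials as transfer matrix entries -/

section CharacteristicPolynomial

open Polynomial

theorem eval_charpoly_dirichlet_zero (V : ℤ → ℂ) (z : ℂ) :
    (dirichlet V 0).charpoly.eval z = 1 := by
  rw [Matrix.eval_charpoly, Matrix.det_fin_zero]

theorem eval_charpoly_dirichlet_one (V : ℤ → ℂ) (z : ℂ) :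
    (dirichlet V 1).charpoly.eval z = z - V 0 := by
  rw [Matrix.eval_charpoly, Matrix.det_fin_one]
  simp [dirichlet]

/-- Laplace expansion along the first row. The off-diagonal entries of `z - H` are `+1`, so the
second term carries only the cofactor sign. -/
theorem eval_charpoly_dirichlet_add_two (V : ℤ → ℂ) (n : ℕ) (z : ℂ) :
    (dirichlet V (n + 2)).charpoly.eval z
      = (z - V 0) * (dirichlet (fun k => V (k + 1)) (n + 1)).charpoly.eval z
        - (dirichlet (fun k => V (k + 1 + 1)) n).charpoly.eval z := by
  simp only [Matrix.eval_charpoly]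
  set M := Matrix.scalar (Fin (n + 2)) z - dirichlet V (n + 2) with hM
  have entry : ∀ (W : ℤ → ℂ) (m : ℕ) (i j : Fin m), (Matrix.scalar (Fin m) z - dirichlet W m) i j
      = if (j : ℕ) = i + 1 then 1 else if (i : ℕ) = j + 1 then 1
        else if i = j then z - W (i : ℕ) else 0 := by
    intro W m i j
    simp only [dirichlet, Matrix.sub_apply, Matrix.scalar_apply, Matrix.diagonal_apply,
      Matrix.of_apply, Fin.ext_iff]
    split_ifs <;> first | omega | simp
  have h1 : M.submatrix Fin.succ (Fin.succAbove 0)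
      = Matrix.scalar (Fin (n + 1)) z - dirichlet (fun k => V (k + 1)) (n + 1) := by
    ext i j
    rw [Matrix.submatrix_apply, hM, entry, entry]
    simp only [Fin.zero_succAbove, Fin.val_succ, Fin.ext_iff]
    push_cast
    split_ifs <;> first | omega | rfl
  -- Without row `0` and column `1`, the first column has a single nonzero entry, the `1` at its
  -- top.
  have h2 : (M.submatrix Fin.succ (Fin.succAbove 1)).det
      = (Matrix.scalar (Fin n) z - dirichlet (fun k => V (k + 1 + 1)) n).det := by
    rw [Matrix.det_succ_column_zero, Fin.sum_univ_succ, Finset.sum_eq_zero]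
    · have h3 : (M.submatrix Fin.succ (Fin.succAbove 1)) 0 0 = 1 := by
        rw [Matrix.submatrix_apply, hM, entry]
        simp
      have h4 : (M.submatrix Fin.succ (Fin.succAbove 1)).submatrix (Fin.succAbove 0) Fin.succ
          = Matrix.scalar (Fin n) z - dirichlet (fun k => V (k + 1 + 1)) n := by
        ext i j
        have h5 : (Fin.succAbove (1 : Fin (n + 2)) j.succ : ℕ) = j + 2 := by
          rw [Fin.succAbove_of_lt_succ _ _ (by simp [Fin.lt_def])]
          simp
        rw [Matrix.submatrix_apply, Matrix.submatrix_apply, hM, entry, entry]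
        simp only [Fin.zero_succAbove, Fin.val_succ, Fin.ext_iff, h5]
        push_cast
        split_ifs <;> first | omega | rfl
      rw [h3, h4]
      simp
    · intro i _
      have h3 : (M.submatrix Fin.succ (Fin.succAbove 1)) i.succ 0 = 0 := by
        rw [Matrix.submatrix_apply, hM, entry]
        simp [Fin.ext_iff]
      rw [h3]
      simp
  rw [Matrix.det_succ_row_zero, Fin.sum_univ_succ, Fin.sum_univ_succ, Finset.sum_eq_zero]
  · rw [h1, Fin.succ_zero_eq_one, h2]
    have e0 : M 0 0 = z - V 0 := by
      rw [hM, entry]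
      simp
    have e1 : M 0 1 = 1 := by
      rw [hM, entry]
      simp
    rw [e0, e1]
    simp
    ring
  · intro i _
    have h3 : M 0 i.succ.succ = 0 := by
      rw [hM, entry]
      simp [Fin.ext_iff]
    rw [h3]
    simp

variable {X : Type*}

theorem orbit_succ (T : X ≃ X) (n : ℕ) (x : X) : orbit T (n + 1 : ℕ) x = orbit T n (T x) := by
  rw [orbit_natCast, orbit_natCast, Function.iterate_succ_apply]

theorem orbit_zero (T : X ≃ X) (x : X) : orbit T 0 x = x := by
  rw [orbit, zpow_zero, Equiv.Perm.one_apply]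

theorem transferMatrix_succ (T : X ≃ X) (v : X → ℝ) (E : ℂ) (n : ℕ) (x : X) :
    transferMatrix T v E (n + 1) x
      = schrodingerMatrix v E (orbit T n x) * transferMatrix T v E n x := rfl

theorem transferMatrix_succ' (T : X ≃ X) (v : X → ℝ) (E : ℂ) (n : ℕ) (x : X) :
    transferMatrix T v E (n + 1) x = transferMatrix T v E n (T x) * schrodingerMatrix v E x := by
  induction n with
  | zero => simp [transferMatrix, orbit_zero]
  | succ n ih =>
    rw [transferMatrix, ih, transferMatrix, Matrix.mul_assoc, orbit_succ]

theorem transferMatrix_add (T : X ≃ X) (v : X → ℝ) (E : ℂ) (m n : ℕ) (x : X) :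
    transferMatrix T v E (m + n) x
      = transferMatrix T v E m (T^[n] x) * transferMatrix T v E n x := by
  induction n generalizing x with
  | zero => simp [transferMatrix]
  | succ n ih =>
    rw [← add_assoc, transferMatrix_succ', ih, transferMatrix_succ', Matrix.mul_assoc,
      Function.iterate_succ_apply]

/-- The upper left entry of the transfer matrix. -/
def transferEntry (T : X ≃ X) (v : X → ℝ) (E : ℂ) (n : ℕ) (x : X) : ℂ :=
  transferMatrix T v E n x 0 0

variable {T : X ≃ X} {v : X → ℝ} {E : ℂ}

/-- With `a_n` the upper left entry, this lemma and the next two give `A_{n+2}(x)` the rows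
`(a_{n+2}(x), -a_{n+1}(Tx))` and `(a_{n+1}(x), -a_n(Tx))`, so bounds on `a` control the matrix. -/
theorem transferMatrix_succ_one_zero (n : ℕ) (x : X) :
    transferMatrix T v E (n + 1) x 1 0 = transferEntry T v E n x := by
  simp [transferMatrix, schrodingerMatrix, Matrix.mul_apply, Fin.sum_univ_two, transferEntry]

theorem transferMatrix_succ_zero_one (n : ℕ) (x : X) :
    transferMatrix T v E (n + 1) x 0 1 = -transferEntry T v E n (T x) := by
  simp [transferMatrix_succ', schrodingerMatrix, Matrix.mul_apply, Fin.sum_univ_two, transferEntry]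

theorem transferMatrix_add_two_one_one (n : ℕ) (x : X) :
    transferMatrix T v E (n + 2) x 1 1 = -transferEntry T v E n (T x) := by
  rw [← transferMatrix_succ_zero_one, transferMatrix_succ, Matrix.mul_apply, Fin.sum_univ_two]
  simp [schrodingerMatrix]

theorem transferEntry_zero (x : X) : transferEntry T v E 0 x = 1 := by
  simp [transferEntry, transferMatrix]

theorem transferEntry_one (x : X) : transferEntry T v E 1 x = v x - E := by
  simp [transferEntry, transferMatrix, schrodingerMatrix, orbit_zero]

theorem transferEntry_add_two (n : ℕ) (x : X) :
    transferEntry T v E (n + 2) x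
      = (v (orbit T (n + 1 : ℕ) x) - E) * transferEntry T v E (n + 1) x
        - transferEntry T v E n x := by
  have h : transferEntry T v E (n + 2) x
      = (v (orbit T (n + 1 : ℕ) x) - E) * transferEntry T v E (n + 1) x
        - transferMatrix T v E (n + 1) x 1 0 := by
    rw [transferEntry, transferMatrix_succ, Matrix.mul_apply, Fin.sum_univ_two]
    simp [schrodingerMatrix, transferEntry]
    ring
  rw [h, transferMatrix_succ_one_zero]

theorem transferEntry_add_two' (n : ℕ) (x : X) :
    transferEntry T v E (n + 2) x
      = (v x - E) * transferEntry T v E (n + 1) (T x) - transferEntry T v E n (T (T x)) := by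
  have h : transferEntry T v E (n + 2) x
      = (v x - E) * transferEntry T v E (n + 1) (T x) + transferMatrix T v E (n + 1) (T x) 0 1 := by
    simp only [transferEntry, transferMatrix_succ' T v E (n + 1), schrodingerMatrix,
      Matrix.mul_apply, Fin.sum_univ_two]
    simp
    ring
  rw [h, transferMatrix_succ_zero_one]
  ring

/-- Both sides satisfy the same three-term recursion in the starting point. The sign arises because
one uses `E - v` and the other `v - E`. -/
theorem eval_charpoly_eq_transferEntry (n : ℕ) (x : X) :
    (dirichlet (fun k => ((v (orbit T k x) : ℝ) : ℂ)) n).charpoly.eval E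
      = (-1) ^ n * transferEntry T v E n x := by
  have horb : ∀ x, (fun k : ℤ => ((v (orbit T (k + 1) x) : ℝ) : ℂ))
      = fun k => ((v (orbit T k (T x)) : ℝ) : ℂ) := fun x => funext fun k => by
    have : T x = orbit T 1 x := by rw [orbit, zpow_one]
    rw [this, orbit_orbit]
  induction n using Nat.twoStepInduction generalizing x with
  | zero => rw [eval_charpoly_dirichlet_zero, transferEntry_zero, pow_zero, one_mul]
  | one =>
    rw [eval_charpoly_dirichlet_one, transferEntry_one, orbit_zero]
    ring
  | more n h1 h2 =>
    rw [eval_charpoly_dirichlet_add_two, horb]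
    have h3 : (fun k : ℤ => ((v (orbit T (k + 1 + 1) x) : ℝ) : ℂ))
        = fun k => ((v (orbit T k (T (T x))) : ℝ) : ℂ) := by
      rw [← horb]
      exact funext fun k => congr_fun (horb x) (k + 1)
    rw [h3, h1, h2, transferEntry_add_two', orbit_zero]
    ring

/-- The Riccati recursion preserves the half plane `{s | η² ≤ -η Im s}`. -/
theorem riccati_step {η : ℝ} {s w : ℂ} (hw : w.im = -η) (hs : η ^ 2 ≤ s.im * -η) :
    η ^ 2 ≤ (w - s⁻¹).im * -η := by
  rw [Complex.sub_im, Complex.inv_im, hw]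
  -- `-1/s` has an imaginary part of the same sign as that of `s`, so it only adds to the
  -- contribution `η²` of `w`.
  have h1 : 0 ≤ s.im * -η / Complex.normSq s :=
    div_nonneg ((sq_nonneg η).trans hs) (Complex.normSq_nonneg s)
  have h2 : (-η - -s.im / Complex.normSq s) * -η = η ^ 2 + s.im * -η / Complex.normSq s := by ring
  rw [h2]
  linarith

theorem abs_le_norm_of_le {η : ℝ} (hη : η ≠ 0) {s : ℂ} (hs : η ^ 2 ≤ s.im * -η) : |η| ≤ ‖s‖ := by
  have h1 : |η| * |η| ≤ |s.im| * |η| := by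
    rw [← abs_mul, ← abs_mul, abs_of_nonneg (mul_self_nonneg η)]
    have := neg_le_abs (s.im * η)
    nlinarith
  exact (le_of_mul_le_mul_right h1 (abs_pos.2 hη)).trans (Complex.abs_im_le_norm s)

/-- Consecutive ratios obey `s ↦ (v - E) - 1/s`, so they stay at distance at least `|Im E|` from the
real axis. In particular no entry vanishes, which keeps the induction going. -/
theorem transferEntry_ratio (hE : E.im ≠ 0) (n : ℕ) (x : X) :
    transferEntry T v E n x ≠ 0 ∧
      E.im ^ 2 ≤ (transferEntry T v E (n + 1) x / transferEntry T v E n x).im * -E.im := by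
  induction n with
  | zero =>
    simp only [zero_add, transferEntry_zero, transferEntry_one, div_one]
    exact ⟨one_ne_zero, by simp [sq]⟩
  | succ n ih =>
    have h0 : transferEntry T v E (n + 1) x ≠ 0 := by
      intro h
      have := abs_le_norm_of_le hE ih.2
      rw [h, zero_div, norm_zero] at this
      exact hE (abs_eq_zero.1 (le_antisymm this (abs_nonneg _)))
    refine ⟨h0, ?_⟩
    have h1 : transferEntry T v E (n + 1 + 1) x / transferEntry T v E (n + 1) x
        = (v (orbit T (n + 1 : ℕ) x) - E)
          - (transferEntry T v E (n + 1) x / transferEntry T v E n x)⁻¹ := by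
      rw [transferEntry_add_two]
      field_simp
    rw [h1]
    exact riccati_step (by simp) ih.2

/-- The same Riccati argument with the product shortened at its starting point, needed for the
second column. -/
theorem transferEntry_ratio' (hE : E.im ≠ 0) (n : ℕ) (x : X) :
    E.im ^ 2 ≤ (transferEntry T v E (n + 1) x / transferEntry T v E n (T x)).im * -E.im := by
  induction n generalizing x with
  | zero =>
    simp only [zero_add, transferEntry_zero, transferEntry_one, div_one]
    simp [sq]
  | succ n ih =>
    have h0 : transferEntry T v E (n + 1) (T x) ≠ 0 := (transferEntry_ratio hE (n + 1) (T x)).1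
    have h1 : transferEntry T v E (n + 1 + 1) x / transferEntry T v E (n + 1) (T x)
        = (v x - E) - (transferEntry T v E (n + 1) (T x) / transferEntry T v E n (T (T x)))⁻¹ := by
      rw [transferEntry_add_two']
      field_simp
    rw [h1]
    exact riccati_step (by simp) (ih (T x))

theorem norm_transferEntry_le (hE : E.im ≠ 0) (n : ℕ) (x : X) :
    ‖transferEntry T v E n x‖ ≤ |E.im|⁻¹ * ‖transferEntry T v E (n + 1) x‖ := by
  have h := abs_le_norm_of_le hE (transferEntry_ratio (T := T) (v := v) hE n x).2
  have h0 := norm_pos_iff.2 (transferEntry_ratio (T := T) (v := v) hE n x).1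
  rw [norm_div, le_div_iff₀ h0] at h
  rwa [inv_mul_eq_div, le_div_iff₀ (abs_pos.2 hE), mul_comm]

theorem norm_transferEntry_le' (hE : E.im ≠ 0) (n : ℕ) (x : X) :
    ‖transferEntry T v E n (T x)‖ ≤ |E.im|⁻¹ * ‖transferEntry T v E (n + 1) x‖ := by
  have h := abs_le_norm_of_le hE (transferEntry_ratio' (T := T) (v := v) hE n x)
  have h0 := norm_pos_iff.2 (transferEntry_ratio (T := T) (v := v) hE n (T x)).1
  rw [norm_div, le_div_iff₀ h0] at h
  rwa [inv_mul_eq_div, le_div_iff₀ (abs_pos.2 hE), mul_comm]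

/-- Off the real axis, every entry of the transfer matrix is controlled by the upper left one. -/
theorem sum_norm_transferMatrix_le (hE : E.im ≠ 0) (n : ℕ) (x : X) :
    ∑ i, ∑ j, ‖transferMatrix T v E (n + 2) x i j‖
      -- With `κ = |Im E|⁻¹`, the four entries cost `1`, `κ`, `κ` and `κ²`, since the last one is
      -- two steps away.
      ≤ (1 + |E.im|⁻¹) ^ 2 * ‖transferEntry T v E (n + 2) x‖ := by
  have h1 := norm_transferEntry_le (T := T) (v := v) hE (n + 1) x
  have h2 := norm_transferEntry_le' (T := T) (v := v) hE (n + 1) x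
  have h3 := norm_transferEntry_le (T := T) (v := v) hE n (T x)
  have h4 : |E.im|⁻¹ * ‖transferEntry T v E (n + 1) (T x)‖
      ≤ |E.im|⁻¹ * (|E.im|⁻¹ * ‖transferEntry T v E (n + 2) x‖) :=
    mul_le_mul_of_nonneg_left h2 (by positivity)
  simp only [Fin.sum_univ_two]
  rw [transferMatrix_succ_one_zero, transferMatrix_succ_zero_one, transferMatrix_add_two_one_one,
    norm_neg, norm_neg]
  have h5 : ‖transferMatrix T v E (n + 2) x 0 0‖ = ‖transferEntry T v E (n + 2) x‖ := rfl
  rw [h5]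
  nlinarith

end CharacteristicPolynomial

/-! ### Existence of the Lyapunov exponent -/

section Lyapunov

open scoped Matrix.Norms.L2Operator

section Norms

variable {m : Type*} [Fintype m] [DecidableEq m]

theorem norm_entry_le_l2_opNorm (A : Matrix m m ℂ) (i j : m) : ‖A i j‖ ≤ ‖A‖ := by
  have h := A.l2_opNorm_mulVec (EuclideanSpace.single j 1)
  rw [PiLp.norm_single, norm_one, mul_one] at h
  refine le_trans ?_ h
  have h2 := PiLp.norm_apply_le ((EuclideanSpace.equiv m ℂ).symm
    (A.mulVec (EuclideanSpace.single j (1 : ℂ)).ofLp)) i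
  refine le_trans (le_of_eq ?_) h2
  congr 1
  simp

/-- By the C*-identity the squared norm is that of a diagonal matrix with the single entry `|c|²`.
-/
theorem l2_opNorm_single_le (i j : m) (c : ℂ) : ‖Matrix.single i j c‖ ≤ ‖c‖ := by
  have h := Matrix.l2_opNorm_conjTranspose_mul_self (Matrix.single i j c)
  rw [Matrix.conjTranspose_single, Matrix.single_mul_single_same, ← Matrix.diagonal_single,
    Matrix.l2_opNorm_diagonal, Pi.norm_single] at h
  rw [norm_mul, norm_star] at h
  nlinarith [norm_nonneg c, norm_nonneg (Matrix.single i j c)]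

theorem l2_opNorm_le_sum (A : Matrix m m ℂ) : ‖A‖ ≤ ∑ i, ∑ j, ‖A i j‖ := by
  conv_lhs => rw [Matrix.matrix_eq_sum_single A]
  refine norm_sum_le_of_le _ fun i _ => norm_sum_le_of_le _ fun j _ => l2_opNorm_single_le i j _

theorem measurable_l2_opNorm {α : Type*} [MeasurableSpace α] {A : α → Matrix m m ℂ}
    (hA : ∀ i j, Measurable fun a => A a i j) : Measurable fun a => ‖A a‖ := by
  have h : Continuous fun M : m → m → ℂ => ‖Matrix.of M‖ := by
    exact (continuous_norm (E := Matrix m m ℂ))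
  exact h.measurable.comp (measurable_pi_iff.2 fun i => measurable_pi_iff.2 fun j => hA i j)

end Norms

variable {X : Type*} [MeasurableSpace X] {μ : Measure X} [IsProbabilityMeasure μ] {T : X ≃ᵐ X}
  {v : X → ℝ} {C : ℝ}

theorem measurable_transferMatrix (hv : Measurable v) (E : ℂ) (n : ℕ) (i j : Fin 2) :
    Measurable fun x => transferMatrix T.toEquiv v E n x i j := by
  induction n generalizing i j with
  | zero => exact measurable_const
  | succ n ih =>
    simp only [transferMatrix_succ, Matrix.mul_apply, Fin.sum_univ_two]
    have h1 : ∀ k l, Measurable fun x => schrodingerMatrix v E (orbit T.toEquiv n x) k l := by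
      intro k l
      have h2 : Measurable fun x => (v (orbit T.toEquiv n x) : ℂ) - E :=
        (Complex.measurable_ofReal.comp (hv.comp (measurable_orbit T n))).sub_const E
      fin_cases k <;> fin_cases l
      · exact h2
      all_goals exact measurable_const
    exact ((h1 i 0).mul (ih 0 j)).add ((h1 i 1).mul (ih 1 j))

theorem norm_schrodingerMatrix_le (hC : ∀ x, |v x| ≤ C) (E : ℂ) (x : X) :
    ‖schrodingerMatrix v E x‖ ≤ C + ‖E‖ + 2 := by
  refine (l2_opNorm_le_sum _).trans ?_
  have h1 : ‖(v x : ℂ) - E‖ ≤ C + ‖E‖ :=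
    (norm_sub_le _ _).trans (by simpa using hC x)
  simp only [schrodingerMatrix, Fin.sum_univ_two]
  norm_num
  linarith

/-- The one-step matrix has determinant `1` and an explicit inverse of comparable size, which keeps
the logarithms of the norms bounded below. -/
theorem norm_le_norm_schrodingerMatrix_mul (hC : ∀ x, |v x| ≤ C) (E : ℂ) (x : X)
    (A : Matrix (Fin 2) (Fin 2) ℂ) : ‖A‖ ≤ (C + ‖E‖ + 2) * ‖schrodingerMatrix v E x * A‖ := by
  let S' : Matrix (Fin 2) (Fin 2) ℂ := !![0, 1; -1, (v x : ℂ) - E]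
  have h0 : S' * schrodingerMatrix v E x = 1 := by
    simp [S', schrodingerMatrix, Matrix.one_fin_two]
  have h1 : ‖S'‖ ≤ C + ‖E‖ + 2 := by
    refine (l2_opNorm_le_sum _).trans ?_
    have h1 : ‖(v x : ℂ) - E‖ ≤ C + ‖E‖ :=
      (norm_sub_le _ _).trans (by simpa using hC x)
    simp only [S', Fin.sum_univ_two]
    norm_num
    linarith
  calc ‖A‖ = ‖S' * (schrodingerMatrix v E x * A)‖ := by
        rw [← Matrix.mul_assoc, h0, Matrix.one_mul]
    _ ≤ ‖S'‖ * ‖schrodingerMatrix v E x * A‖ := Matrix.l2_opNorm_mul _ _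
    _ ≤ _ := mul_le_mul_of_nonneg_right h1 (norm_nonneg _)

theorem norm_transferMatrix_le (hC : ∀ x, |v x| ≤ C) (E : ℂ) (n : ℕ) (x : X) :
    ‖transferMatrix T.toEquiv v E n x‖ ≤ (C + ‖E‖ + 2) ^ n := by
  induction n with
  | zero =>
    rw [pow_zero, transferMatrix, norm_one]
  | succ n ih =>
    rw [transferMatrix_succ, pow_succ']
    exact (Matrix.l2_opNorm_mul _ _).trans (mul_le_mul (norm_schrodingerMatrix_le hC E _) ih
      (norm_nonneg _) ((norm_nonneg _).trans (norm_schrodingerMatrix_le hC E x)))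

theorem one_le_norm_transferMatrix (hC : ∀ x, |v x| ≤ C) (E : ℂ) (n : ℕ) (x : X) :
    1 ≤ (C + ‖E‖ + 2) ^ n * ‖transferMatrix T.toEquiv v E n x‖ := by
  induction n with
  | zero => rw [pow_zero, transferMatrix, norm_one, one_mul]
  | succ n ih =>
    rw [transferMatrix_succ, pow_succ, mul_assoc]
    have h0 : 0 ≤ C + ‖E‖ + 2 := (norm_nonneg _).trans (norm_schrodingerMatrix_le hC E x)
    exact ih.trans (mul_le_mul_of_nonneg_left (norm_le_norm_schrodingerMatrix_mul hC E _ _)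
      (by positivity))

theorem norm_transferMatrix_pos (hC : ∀ x, |v x| ≤ C) (E : ℂ) (n : ℕ) (x : X) :
    0 < ‖transferMatrix T.toEquiv v E n x‖ := by
  have h := one_le_norm_transferMatrix (T := T) hC E n x
  have h0 : 0 ≤ C + ‖E‖ + 2 := (norm_nonneg _).trans (norm_schrodingerMatrix_le hC E x)
  rcases (norm_nonneg (transferMatrix T.toEquiv v E n x)).eq_or_lt with h1 | h1
  · rw [← h1, mul_zero] at h
    linarith
  · exact h1

theorem abs_log_norm_transferMatrix_le (hC : ∀ x, |v x| ≤ C) (E : ℂ) (n : ℕ) (x : X) :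
    |Real.log ‖transferMatrix T.toEquiv v E n x‖| ≤ n * Real.log (C + ‖E‖ + 2) := by
  have hp := norm_transferMatrix_pos (T := T) hC E n x
  have h0 : 0 < C + ‖E‖ + 2 := by
    have := (abs_nonneg _).trans (hC x)
    positivity
  have h1 := Real.log_le_log hp (norm_transferMatrix_le (T := T) hC E n x)
  have h2 := Real.log_le_log one_pos (one_le_norm_transferMatrix (T := T) hC E n x)
  rw [Real.log_mul (pow_pos h0 n).ne' hp.ne', Real.log_one] at h2
  rw [Real.log_pow] at h1 h2
  exact abs_le.2 ⟨by linarith, h1⟩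

theorem measurable_log_norm_transferMatrix (hv : Measurable v) (E : ℂ) (n : ℕ) :
    Measurable fun x => Real.log ‖transferMatrix T.toEquiv v E n x‖ :=
  Real.measurable_log.comp (measurable_l2_opNorm (measurable_transferMatrix hv E n))

theorem integrable_log_norm_transferMatrix (hv : Measurable v) (hC : ∀ x, |v x| ≤ C) (E : ℂ)
    (n : ℕ) : Integrable (fun x => Real.log ‖transferMatrix T.toEquiv v E n x‖) μ :=
  Integrable.of_bound (measurable_log_norm_transferMatrix hv E n).aestronglyMeasurable _
    (ae_of_all _ fun x => abs_log_norm_transferMatrix_le hC E n x)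

theorem finiteLyapunov_eq (E : ℂ) (n : ℕ) :
    finiteLyapunov μ T.toEquiv v E n
      = (∫ x, Real.log ‖transferMatrix T.toEquiv v E n x‖ ∂μ) / n := by
  rw [finiteLyapunov, integral_const_mul, one_div, inv_mul_eq_div]

/-- The limit defining the Lyapunov exponent exists. -/
theorem tendsto_finiteLyapunov (hT : MeasurePreserving T μ μ) (hv : Measurable v)
    (hC : ∀ x, |v x| ≤ C) (E : ℂ) :
    Tendsto (finiteLyapunov μ T.toEquiv v E) atTop (𝓝 (lyapunov μ T.toEquiv v E)) := by
  have hi := integrable_log_norm_transferMatrix (μ := μ) (T := T) hv hC E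
  -- The cocycle identity, submultiplicativity of the norm and invariance of `μ` give subadditivity;
  -- Fekete's lemma then gives the limit.
  have hsub : Subadditive fun n => ∫ x, Real.log ‖transferMatrix T.toEquiv v E n x‖ ∂μ := by
    intro m n
    have hmp := hT.iterate n
    have h1 := integral_map (μ := μ) hmp.measurable.aemeasurable
      (f := fun x => Real.log ‖transferMatrix T.toEquiv v E m x‖)
      (measurable_log_norm_transferMatrix hv E m).aestronglyMeasurable
    rw [hmp.map_eq] at h1
    have hi' : Integrable (fun x => Real.log ‖transferMatrix T.toEquiv v E m (T^[n] x)‖) μ :=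
      hmp.integrable_comp_of_integrable (hi m)
    beta_reduce
    rw [h1, ← integral_add hi' (hi n)]
    refine integral_mono (hi (m + n)) (hi'.add (hi n)) fun x => ?_
    have hp := norm_transferMatrix_pos (T := T) hC E
    change Real.log _ ≤ Real.log _ + Real.log _
    rw [← Real.log_mul (hp m _).ne' (hp n x).ne']
    refine Real.log_le_log (hp (m + n) x) ?_
    rw [transferMatrix_add]
    exact Matrix.l2_opNorm_mul _ _
  have hbdd : BddBelow (Set.range fun n : ℕ =>
      (∫ x, Real.log ‖transferMatrix T.toEquiv v E n x‖ ∂μ) / n) := by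
    refine ⟨-Real.log (C + ‖E‖ + 2), ?_⟩
    rintro _ ⟨n, rfl⟩
    have h1 : ‖∫ x, Real.log ‖transferMatrix T.toEquiv v E n x‖ ∂μ‖
        ≤ n * Real.log (C + ‖E‖ + 2) := by
      simpa using norm_integral_le_of_norm_le_const (μ := μ)
        (ae_of_all _ fun x => (Real.norm_eq_abs _).trans_le
          (abs_log_norm_transferMatrix_le (T := T) hC E n x))
    rw [Real.norm_eq_abs] at h1
    have h2 := (abs_le.1 h1).1
    rcases Nat.eq_zero_or_pos n with rfl | hn
    · have : Nonempty X := μ.nonempty_of_neZero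
      obtain ⟨x⟩ := this
      have h3 : 0 ≤ Real.log (C + ‖E‖ + 2) := by
        refine Real.log_nonneg ?_
        linarith [(abs_nonneg _).trans (hC x), norm_nonneg E]
      simpa using h3
    · change _ ≤ _ / _
      rw [le_div_iff₀ (by exact_mod_cast hn)]
      linarith
  have h := hsub.tendsto_lim hbdd
  have h2 : Tendsto (finiteLyapunov μ T.toEquiv v E) atTop (𝓝 hsub.lim) :=
    h.congr fun n => (finiteLyapunov_eq E n).symm
  rw [lyapunov, h2.limUnder_eq]
  exact h2

end Lyapunov

/-! ### The Thouless formula off the real axis -/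

section Thouless

open scoped Matrix.Norms.L2Operator

variable {X : Type*} [TopologicalSpace X] [CompactSpace X]

theorem continuous_log_norm_sub {E : ℂ} (hE : E.im ≠ 0) :
    Continuous fun t : ℝ => Real.log ‖E - t‖ := by
  refine Continuous.log (by fun_prop) fun t h => hE ?_
  have := congrArg Complex.im (norm_eq_zero.1 h)
  simpa using this

theorem eigenAverage_log_norm_sub {E : ℂ} (hE : E.im ≠ 0) (T : X ≃ X) (v : C(X, ℝ)) (x : X)
    (n : ℕ) :
    eigenAverage (potential T v x) n (fun t => Real.log ‖E - t‖)
      = (n : ℝ)⁻¹ * Real.log ‖transferEntry T v E n x‖ := by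
  rw [eigenAverage_eq (conj_potential T v x)]
  congr 1
  have h1 := eval_charpoly_eq_transferEntry (T := T) (v := v) (E := E) n x
  have h2 : (dirichlet (potential T v x) n).charpoly.eval E
      = (-1) ^ n * transferEntry T v E n x := h1
  have h3 : ‖transferEntry T v E n x‖ = ‖(dirichlet (potential T v x) n).charpoly.eval E‖ := by
    rw [h2, norm_mul, norm_pow, norm_neg, norm_one, one_pow, one_mul]
  rw [h3, (isHermitian_dirichlet (conj_potential T v x) n).charpoly_eq, Polynomial.eval_prod,
    norm_prod, Real.log_prod]
  · refine Finset.sum_congr rfl fun i _ => ?_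
    simp
  · intro i _ h
    refine hE ?_
    have := congrArg Complex.im (norm_eq_zero.1 h)
    simpa using this

variable [MeasurableSpace X] [BorelSpace X] {μ : Measure X} [IsProbabilityMeasure μ]
  {T : X ≃ᵐ X} {v : C(X, ℝ)}

/-- `log ‖A_n‖` and `log |a_n|` differ by at most the constant `log K`, which disappears after
division by `n`. The average of `log |a_n|` is an eigenvalue average of `t ↦ log |E - t|`,
continuous because `E` is not real. -/
theorem IsGeneric.tendsto_log_norm_transferMatrix {x : X} (hx : IsGeneric μ T v x) {E : ℂ}
    (hE : E.im ≠ 0) :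
    Tendsto (fun n : ℕ => 1 / (n : ℝ) * Real.log ‖transferMatrix T.toEquiv v E n x‖) atTop
      (𝓝 (dosFunctional μ T v fun t => Real.log ‖E - t‖)) := by
  have h1 := hx.tendsto_eigenAverage (continuous_log_norm_sub hE)
  simp_rw [eigenAverage_log_norm_sub hE] at h1
  set K := (1 + |E.im|⁻¹) ^ 2 with hK
  have hK1 : 0 < K := by positivity
  have h2 : Tendsto (fun n : ℕ => Real.log K / n) atTop (𝓝 0) :=
    tendsto_const_div_atTop_nhds_zero_nat _
  have h3 := h1.add h2
  rw [add_zero] at h3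
  refine tendsto_of_tendsto_of_tendsto_of_le_of_le' h1 h3 ?_ ?_
  · filter_upwards with n
    rw [one_div]
    refine mul_le_mul_of_nonneg_left (Real.log_le_log ?_ (norm_entry_le_l2_opNorm _ 0 0))
      (by positivity)
    exact norm_pos_iff.2 (transferEntry_ratio hE n x).1
  · filter_upwards [eventually_ge_atTop 2] with n hn
    obtain ⟨m, rfl⟩ := Nat.exists_eq_add_of_le' hn
    have hp : 0 < ‖transferEntry T.toEquiv v E (m + 2) x‖ :=
      norm_pos_iff.2 (transferEntry_ratio hE (m + 2) x).1
    have h4 : ‖transferMatrix T.toEquiv v E (m + 2) x‖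
        ≤ K * ‖transferEntry T.toEquiv v E (m + 2) x‖ :=
      (l2_opNorm_le_sum _).trans (sum_norm_transferMatrix_le hE m x)
    have h5 : 0 < ‖transferMatrix T.toEquiv v E (m + 2) x‖ :=
      hp.trans_le (norm_entry_le_l2_opNorm _ 0 0)
    have h6 := Real.log_le_log h5 h4
    rw [Real.log_mul hK1.ne' hp.ne'] at h6
    rw [one_div, div_eq_inv_mul, ← mul_add]
    exact mul_le_mul_of_nonneg_left (by linarith) (by positivity)

/-- The **Thouless formula** off the real axis. -/
theorem lyapunov_eq_dosFunctional (hT : Ergodic T μ) {E : ℂ} (hE : E.im ≠ 0) :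
    lyapunov μ T.toEquiv v E = dosFunctional μ T v fun t => Real.log ‖E - t‖ := by
  have hv : Measurable v := v.continuous.measurable
  have hC : ∀ x, |v x| ≤ ‖v‖ := fun x => v.norm_coe_le_norm x
  refine tendsto_nhds_unique (tendsto_finiteLyapunov hT.toMeasurePreserving hv hC E) ?_
  -- The pointwise limit is the same constant for almost every `x`; the uniform bound on the
  -- logarithms allows it to be integrated.
  have h : Tendsto (finiteLyapunov μ T.toEquiv v E) atTop
      (𝓝 (∫ _, dosFunctional μ T v (fun t => Real.log ‖E - t‖) ∂μ)) := by
    refine tendsto_integral_of_dominated_convergence (fun _ => Real.log (‖v‖ + ‖E‖ + 2))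
      (fun n => ((measurable_log_norm_transferMatrix hv E n).const_mul _).aestronglyMeasurable)
      (integrable_const _) (fun n => ae_of_all _ fun x => ?_) ?_
    · have h1 := abs_log_norm_transferMatrix_le (T := T) hC E n x
      have h0 : 0 ≤ Real.log (‖v‖ + ‖E‖ + 2) := by
        refine Real.log_nonneg ?_
        linarith [norm_nonneg v, norm_nonneg E]
      rcases Nat.eq_zero_or_pos n with rfl | hn
      · simpa using h0
      · rw [Real.norm_eq_abs, abs_mul, abs_of_nonneg (by positivity : (0 : ℝ) ≤ 1 / n), one_div,
          inv_mul_le_iff₀ (by exact_mod_cast hn)]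
        exact h1
    · filter_upwards [ae_isGeneric (v := v) hT] with x hx
      exact hx.tendsto_log_norm_transferMatrix hE
  simpa using h

end Thouless

/-! ### The Laplacian of the regularized logarithm -/

section LogKernel

theorem laplacian_eq_fderiv {f : ℂ → ℝ} (hf : ContDiff ℝ ∞ f) (z : ℂ) :
    Laplacian.laplacian f z = fderiv ℝ (fun w => fderiv ℝ f w 1) z 1
      + fderiv ℝ (fun w => fderiv ℝ f w Complex.I) z Complex.I := by
  have h : DifferentiableAt ℝ (fderiv ℝ f) z :=
    ((hf.fderiv_right (m := 1) (by norm_cast)).differentiable (by norm_num)) z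
  have h1 : ∀ u v : ℂ, fderiv ℝ (fun w => fderiv ℝ f w v) z u = fderiv ℝ (fderiv ℝ f) z u v := by
    intro u v
    rw [fderiv_clm_apply h (differentiableAt_const v)]
    simp
  rw [InnerProductSpace.laplacian_eq_iteratedFDeriv_complexPlane, h1, h1]
  simp [iteratedFDeriv_two_apply]

theorem contDiff_fderiv_apply {f : ℂ → ℝ} (hf : ContDiff ℝ ∞ f) (v : ℂ) :
    ContDiff ℝ ∞ fun w => fderiv ℝ f w v :=
  (hf.fderiv_right (m := ∞) (by norm_cast)).clm_apply contDiff_const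

theorem hasCompactSupport_fderiv_apply {f : ℂ → ℝ} (hf : HasCompactSupport f) (v : ℂ) :
    HasCompactSupport fun w => fderiv ℝ f w v :=
  hf.fderiv_apply ℝ v

theorem hasCompactSupport_laplacian {f : ℂ → ℝ} (hf : ContDiff ℝ ∞ f) (hs : HasCompactSupport f) :
    HasCompactSupport (Laplacian.laplacian f) := by
  have h : Laplacian.laplacian f = (fun z => fderiv ℝ (fun w => fderiv ℝ f w 1) z 1)
      + fun z => fderiv ℝ (fun w => fderiv ℝ f w Complex.I) z Complex.I :=
    funext (laplacian_eq_fderiv hf)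
  rw [h]
  exact (hasCompactSupport_fderiv_apply (hasCompactSupport_fderiv_apply hs 1) 1).add
    (hasCompactSupport_fderiv_apply (hasCompactSupport_fderiv_apply hs _) _)

theorem continuous_laplacian {f : ℂ → ℝ} (hf : ContDiff ℝ ∞ f) :
    Continuous (Laplacian.laplacian f) := by
  have h : Laplacian.laplacian f = (fun z => fderiv ℝ (fun w => fderiv ℝ f w 1) z 1)
      + fun z => fderiv ℝ (fun w => fderiv ℝ f w Complex.I) z Complex.I :=
    funext (laplacian_eq_fderiv hf)
  rw [h]
  exact (contDiff_fderiv_apply (contDiff_fderiv_apply hf 1) 1).continuous.add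
    (contDiff_fderiv_apply (contDiff_fderiv_apply hf _) _).continuous

theorem integral_mul_fderiv_fderiv {f φ : ℂ → ℝ} (hf : ContDiff ℝ ∞ f) (hφ : ContDiff ℝ ∞ φ)
    (hs : HasCompactSupport φ) (v : ℂ) :
    ∫ z, f z * fderiv ℝ (fun w => fderiv ℝ φ w v) z v
      = ∫ z, fderiv ℝ (fun w => fderiv ℝ f w v) z v * φ z := by
  have hf1 := contDiff_fderiv_apply hf v
  have hf2 := contDiff_fderiv_apply hf1 v
  have hφ1 := contDiff_fderiv_apply hφ v
  have hφ2 := contDiff_fderiv_apply hφ1 v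
  have hs1 := hasCompactSupport_fderiv_apply hs v
  have hs2 := hasCompactSupport_fderiv_apply hs1 v
  have key : ∀ {a b : ℂ → ℝ}, ContDiff ℝ ∞ a → ContDiff ℝ ∞ b → HasCompactSupport b →
      Integrable fun z => a z * b z := fun ha hb hc =>
    (ha.continuous.mul hb.continuous).integrable_of_hasCompactSupport hc.mul_left
  have htop : (∞ : WithTop ℕ∞) ≠ 0 := by simp
  rw [integral_mul_fderiv_eq_neg_fderiv_mul_of_integrable (key hf1 hφ1 hs1) (key hf hφ2 hs2)
    (key hf hφ1 hs1) (fun z _ => hf.differentiable htop z) (fun z _ => hφ1.differentiable htop z),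
    integral_mul_fderiv_eq_neg_fderiv_mul_of_integrable (key hf2 hφ hs) (key hf1 hφ1 hs1)
    (key hf1 hφ hs) (fun z _ => hf1.differentiable htop z) (fun z _ => hφ.differentiable htop z),
    neg_neg]

/-- Green's identity for a compactly supported function. -/
theorem integral_mul_laplacian {f φ : ℂ → ℝ} (hf : ContDiff ℝ ∞ f) (hφ : ContDiff ℝ ∞ φ)
    (hs : HasCompactSupport φ) :
    ∫ z, f z * Laplacian.laplacian φ z = ∫ z, Laplacian.laplacian f z * φ z := by
  simp_rw [laplacian_eq_fderiv hf, laplacian_eq_fderiv hφ, mul_add, add_mul]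
  have h1 : ∀ v, Integrable fun z => f z * fderiv ℝ (fun w => fderiv ℝ φ w v) z v := fun v =>
    (hf.continuous.mul (contDiff_fderiv_apply (contDiff_fderiv_apply hφ v) v).continuous)
      |>.integrable_of_hasCompactSupport
        (hasCompactSupport_fderiv_apply (hasCompactSupport_fderiv_apply hs v) v).mul_left
  have h2 : ∀ v, Integrable fun z => fderiv ℝ (fun w => fderiv ℝ f w v) z v * φ z := fun v =>
    ((contDiff_fderiv_apply (contDiff_fderiv_apply hf v) v).continuous.mul hφ.continuous)
      |>.integrable_of_hasCompactSupport hs.mul_left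
  rw [integral_add (h1 1) (h1 _), integral_add (h2 1) (h2 _), integral_mul_fderiv_fderiv hf hφ hs,
    integral_mul_fderiv_fderiv hf hφ hs]

/-- The regularization `½ log (|z - a|² + ε²)` of `log |z - a|`. -/
def smoothLog (a : ℂ) (ε : ℝ) (z : ℂ) : ℝ :=
  1 / 2 * Real.log ((z.re - a.re) ^ 2 + (z.im - a.im) ^ 2 + ε ^ 2)

theorem contDiff_smoothLog (a : ℂ) {ε : ℝ} (hε : 0 < ε) : ContDiff ℝ ∞ (smoothLog a ε) := by
  have hre : ContDiff ℝ ∞ fun z : ℂ => z.re := Complex.reCLM.contDiff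
  have him : ContDiff ℝ ∞ fun z : ℂ => z.im := Complex.imCLM.contDiff
  refine contDiff_const.mul (ContDiff.log ?_ fun z => by positivity)
  exact (((hre.sub contDiff_const).pow 2).add ((him.sub contDiff_const).pow 2)).add contDiff_const

theorem hasDerivAt_line (x b w : ℝ) : HasDerivAt (fun s : ℝ => x + s * w - b) w 0 := by
  simpa using (((hasDerivAt_id (0 : ℝ)).mul_const w).const_add x).sub_const b

theorem hasDerivAt_normSq_line (a z v : ℂ) (ε : ℝ) :
    HasDerivAt (fun s : ℝ => (z.re + s * v.re - a.re) ^ 2 + (z.im + s * v.im - a.im) ^ 2 + ε ^ 2)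
      (2 * ((z.re - a.re) * v.re + (z.im - a.im) * v.im)) 0 := by
  refine ((((hasDerivAt_line z.re a.re v.re).pow 2).add
    ((hasDerivAt_line z.im a.im v.im).pow 2)).add_const (ε ^ 2)).congr_deriv ?_
  norm_num
  ring

theorem fderiv_smoothLog (a : ℂ) {ε : ℝ} (hε : 0 < ε) (z v : ℂ) :
    fderiv ℝ (smoothLog a ε) z v = ((z.re - a.re) * v.re + (z.im - a.im) * v.im)
      / ((z.re - a.re) ^ 2 + (z.im - a.im) ^ 2 + ε ^ 2) := by
  have hd := (contDiff_smoothLog a hε).differentiable (by simp) z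
  rw [← hd.lineDeriv_eq_fderiv]
  refine HasDerivAt.deriv ?_
  have hfun : (fun t : ℝ => smoothLog a ε (z + t • v)) = fun s : ℝ => 1 / 2 * Real.log
      ((z.re + s * v.re - a.re) ^ 2 + (z.im + s * v.im - a.im) ^ 2 + ε ^ 2) := by
    ext s
    simp [smoothLog]
  rw [hfun]
  have hq : (z.re + 0 * v.re - a.re) ^ 2 + (z.im + 0 * v.im - a.im) ^ 2 + ε ^ 2 ≠ 0 := by positivity
  refine (((hasDerivAt_normSq_line a z v ε).log hq).const_mul (1 / 2)).congr_deriv ?_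
  rw [zero_mul, zero_mul, add_zero, add_zero]
  ring

theorem fderiv_fderiv_smoothLog (a : ℂ) {ε : ℝ} (hε : 0 < ε) (z v : ℂ) :
    fderiv ℝ (fun w => fderiv ℝ (smoothLog a ε) w v) z v
      = ((v.re * v.re + v.im * v.im) * ((z.re - a.re) ^ 2 + (z.im - a.im) ^ 2 + ε ^ 2)
          - 2 * ((z.re - a.re) * v.re + (z.im - a.im) * v.im) ^ 2)
        / ((z.re - a.re) ^ 2 + (z.im - a.im) ^ 2 + ε ^ 2) ^ 2 := by
  have hd := (contDiff_fderiv_apply (contDiff_smoothLog a hε) v).differentiable (by simp) z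
  rw [← hd.lineDeriv_eq_fderiv]
  refine HasDerivAt.deriv ?_
  have hfun : (fun t : ℝ => fderiv ℝ (smoothLog a ε) (z + t • v) v) = fun s : ℝ =>
      ((z.re + s * v.re - a.re) * v.re + (z.im + s * v.im - a.im) * v.im)
      / ((z.re + s * v.re - a.re) ^ 2 + (z.im + s * v.im - a.im) ^ 2 + ε ^ 2) := by
    ext s
    rw [fderiv_smoothLog a hε]
    simp
  rw [hfun]
  have hq : (z.re + 0 * v.re - a.re) ^ 2 + (z.im + 0 * v.im - a.im) ^ 2 + ε ^ 2 ≠ 0 := by positivity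
  refine ((((hasDerivAt_line z.re a.re v.re).mul_const v.re).add
    ((hasDerivAt_line z.im a.im v.im).mul_const v.im)).div
      (hasDerivAt_normSq_line a z v ε) hq).congr_deriv ?_
  simp only [Pi.add_apply, zero_mul, add_zero]
  congr 1
  ring

/-- With `r = |z - a|` and `q = r² + ε²`, the directions `1` and `i` add up to `(2q - 2r²) / q²`.
This is `2π` times an approximate identity at `a`, of width `ε`. -/
theorem laplacian_smoothLog (a : ℂ) {ε : ℝ} (hε : 0 < ε) (z : ℂ) :
    Laplacian.laplacian (smoothLog a ε) z = 2 * ε ^ 2 / (‖z - a‖ ^ 2 + ε ^ 2) ^ 2 := by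
  rw [laplacian_eq_fderiv (contDiff_smoothLog a hε), fderiv_fderiv_smoothLog a hε,
    fderiv_fderiv_smoothLog a hε, ← Complex.normSq_eq_norm_sq, Complex.normSq_apply]
  have hq : (z.re - a.re) ^ 2 + (z.im - a.im) ^ 2 + ε ^ 2 ≠ 0 := by positivity
  simp only [Complex.one_re, Complex.one_im, Complex.I_re, Complex.I_im, Complex.sub_re,
    Complex.sub_im, ← sq]
  rw [← add_div]
  congr 1
  ring

/-- In polar coordinates the radial integrand has the antiderivative `-(2π)⁻¹ / (y² + 1)`; the total
`1/(2π)` is multiplied by the circumference `2π`. -/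
theorem integral_kernel_eq_one :
    ∫ z : ℂ, (Real.pi)⁻¹ * (1 / (‖z‖ ^ 2 + 1) ^ 2) = 1 := by
  have h := integral_fun_norm_addHaar (volume : Measure ℂ)
    fun y : ℝ => (Real.pi)⁻¹ * (1 / (y ^ 2 + 1) ^ 2)
  rw [h, Complex.finrank_real_complex, measureReal_def, Complex.volume_ball]
  have hd : ∀ y : ℝ, HasDerivAt (fun y : ℝ => -(2 * Real.pi)⁻¹ * (y ^ 2 + 1)⁻¹)
      (y ^ (2 - 1) • ((Real.pi)⁻¹ * (1 / (y ^ 2 + 1) ^ 2))) y := by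
    intro y
    have h0 : y ^ 2 + 1 ≠ 0 := by positivity
    have h1 := (((hasDerivAt_pow 2 y).add_const 1).inv h0).const_mul (-(2 * Real.pi)⁻¹)
    refine h1.congr_deriv ?_
    have hpi := Real.pi_ne_zero
    simp only [smul_eq_mul]
    field_simp
    norm_num
  have hlim : Tendsto (fun y : ℝ => -(2 * Real.pi)⁻¹ * (y ^ 2 + 1)⁻¹) atTop (𝓝 0) := by
    have h1 : Tendsto (fun y : ℝ => y ^ 2 + 1) atTop atTop :=
      tendsto_atTop_add_const_right _ _ (tendsto_pow_atTop two_ne_zero)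
    simpa using h1.inv_tendsto_atTop.const_mul (-(2 * Real.pi)⁻¹)
  rw [integral_Ioi_of_hasDerivAt_of_nonneg' (fun y _ => hd y)
    (fun y hy => by have : 0 < y := hy; positivity) hlim]
  have hpi := Real.pi_ne_zero
  simp [NNReal.coe_real_pi]

end LogKernel

/-! ### The fundamental solution of the Laplacian -/

section LogPotential

/-- The polar Jacobian turns the singularity into `y log y`, which is continuous at `0`. -/
theorem integrableOn_log_norm (r : ℝ) :
    IntegrableOn (fun z : ℂ => Real.log ‖z‖) (Metric.ball 0 r) := by
  rw [integrableOn_fun_norm_addHaar (f := Real.log) volume, Complex.finrank_real_complex]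
  refine (Continuous.integrableOn_Icc (a := 0) (b := r) ?_).mono_set Set.Ioo_subset_Icc_self
  simpa using Real.continuous_mul_log

/-- The logarithmic kernel is integrable against bounded functions of bounded support, uniformly
as long as the pole stays bounded. -/
theorem integrable_log_norm_sub_mul {h : ℂ → ℝ} {C ρ r : ℝ} {a : ℂ} (hh : Measurable h)
    (hC : ∀ z, |h z| ≤ C) (hρ : ∀ z, ρ ≤ ‖z‖ → h z = 0) (hr : ρ + ‖a‖ ≤ r) :
    Integrable (fun z => Real.log ‖z - a‖ * h z) ∧
      ∫ z, ‖Real.log ‖z - a‖ * h z‖ ≤ C * ∫ z in Metric.ball (0 : ℂ) r, |Real.log ‖z‖| := by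
  -- A majorant that depends on `a` only through a translation; translation invariance makes the
  -- bound uniform in the pole.
  set D : ℂ → ℝ := (Metric.ball (0 : ℂ) r).indicator fun z => C * |Real.log ‖z‖| with hD
  have hDi : Integrable D :=
    (integrable_indicator_iff Metric.isOpen_ball.measurableSet).2
      ((integrableOn_log_norm r).abs.const_mul C)
  have hC0 : 0 ≤ C := (abs_nonneg _).trans (hC 0)
  have hb : ∀ z, ‖Real.log ‖z - a‖ * h z‖ ≤ D (z - a) := by
    intro z
    by_cases hz : ρ ≤ ‖z‖
    · rw [hρ z hz, mul_zero, norm_zero]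
      exact Set.indicator_nonneg (fun _ _ => by positivity) _
    · have hm : z - a ∈ Metric.ball (0 : ℂ) r := by
        rw [mem_ball_zero_iff]
        linarith [norm_sub_le z a, not_le.1 hz]
      rw [hD, Set.indicator_of_mem hm, norm_mul, mul_comm, Real.norm_eq_abs, Real.norm_eq_abs]
      exact mul_le_mul_of_nonneg_right (hC z) (abs_nonneg _)
  have hi : Integrable fun z => Real.log ‖z - a‖ * h z :=
    (hDi.comp_sub_right a).mono' (by fun_prop) (Eventually.of_forall hb)
  refine ⟨hi, (integral_mono hi.norm (hDi.comp_sub_right a) hb).trans_eq ?_⟩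
  rw [integral_sub_right_eq_self D a, hD, integral_indicator Metric.isOpen_ball.measurableSet,
    integral_const_mul]

theorem exists_bound_of_hasCompactSupport {h : ℂ → ℝ} (hh : Continuous h)
    (hs : HasCompactSupport h) :
    ∃ C ρ : ℝ, (∀ z, |h z| ≤ C) ∧ ∀ z, ρ ≤ ‖z‖ → h z = 0 := by
  obtain ⟨C, hC⟩ := hh.bounded_above_of_compact_support hs
  obtain ⟨ρ, hρ⟩ := hs.isCompact.isBounded.exists_norm_le
  refine ⟨C, ρ + 1, hC, fun z hz => image_eq_zero_of_notMem_tsupport fun hm => ?_⟩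
  linarith [hρ z hm]

theorem smoothLog_eq (a : ℂ) (ε : ℝ) (z : ℂ) :
    smoothLog a ε z = 1 / 2 * Real.log (‖z - a‖ ^ 2 + ε ^ 2) := by
  rw [smoothLog, ← Complex.normSq_eq_norm_sq, Complex.normSq_apply, Complex.sub_re, Complex.sub_im]
  ring_nf

/-- The regularization lies between `log |z - a|` and its value at `ε = 1`, which gives a majorant
independent of `ε`. -/
theorem abs_smoothLog_le {a z : ℂ} (hz : z ≠ a) {ε : ℝ} (hε : |ε| ≤ 1) :
    |smoothLog a ε z| ≤ |Real.log ‖z - a‖| + smoothLog a 1 z := by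
  have h0 : 0 < ‖z - a‖ := norm_pos_iff.2 (sub_ne_zero.2 hz)
  have h1 : Real.log ‖z - a‖ ≤ smoothLog a ε z := by
    have := Real.log_le_log (by positivity : 0 < ‖z - a‖ ^ 2)
      (le_add_of_nonneg_right (sq_nonneg ε) : ‖z - a‖ ^ 2 ≤ ‖z - a‖ ^ 2 + ε ^ 2)
    rw [Real.log_pow] at this
    rw [smoothLog_eq]
    push_cast at this
    linarith
  have h2 : smoothLog a ε z ≤ smoothLog a 1 z := by
    rw [smoothLog_eq, smoothLog_eq]
    have : ε ^ 2 ≤ 1 ^ 2 := sq_le_sq' (by linarith [abs_le.1 hε]) (abs_le.1 hε).2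
    exact mul_le_mul_of_nonneg_left
      (Real.log_le_log (by positivity) (add_le_add_right this (‖z - a‖ ^ 2))) (by norm_num)
  have h3 : 0 ≤ smoothLog a 1 z := by
    rw [smoothLog_eq]
    exact mul_nonneg (by norm_num) (Real.log_nonneg (by nlinarith [sq_nonneg ‖z - a‖]))
  rw [abs_le]
  constructor <;> linarith [neg_abs_le (Real.log ‖z - a‖), abs_nonneg (Real.log ‖z - a‖)]

theorem tendsto_smoothLog {a z : ℂ} (hz : z ≠ a) :
    Tendsto (fun c : ℝ => smoothLog a c⁻¹ z) atTop (𝓝 (Real.log ‖z - a‖)) := by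
  have h0 : 0 < ‖z - a‖ := norm_pos_iff.2 (sub_ne_zero.2 hz)
  have h1 : Tendsto (fun c : ℝ => ‖z - a‖ ^ 2 + c⁻¹ ^ 2) atTop (𝓝 (‖z - a‖ ^ 2 + 0 ^ 2)) :=
    (tendsto_inv_atTop_zero.pow 2).const_add _
  rw [zero_pow two_ne_zero, add_zero] at h1
  have h2 := (h1.log (by positivity)).const_mul (1 / 2)
  simp only [smoothLog_eq]
  convert h2 using 2
  rw [Real.log_pow]
  push_cast
  ring

theorem tendsto_kernel_cobounded :
    Tendsto (fun z : ℂ => ‖z‖ ^ Module.finrank ℝ ℂ * (Real.pi⁻¹ * (1 / (‖z‖ ^ 2 + 1) ^ 2)))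
      (Bornology.cobounded ℂ) (𝓝 0) := by
  rw [Complex.finrank_real_complex]
  have h1 : Tendsto (fun z : ℂ => Real.pi⁻¹ * ‖z‖⁻¹) (Bornology.cobounded ℂ) (𝓝 0) := by
    simpa using (tendsto_inv_atTop_zero.comp tendsto_norm_cobounded_atTop).const_mul Real.pi⁻¹
  refine squeeze_zero' (Eventually.of_forall fun z => by positivity) ?_ h1
  filter_upwards [tendsto_norm_cobounded_atTop.eventually (eventually_ge_atTop (1 : ℝ))] with z hz
  have hz0 : 0 < ‖z‖ := by linarith
  rw [mul_left_comm]
  refine mul_le_mul_of_nonneg_left ?_ (by positivity)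
  rw [mul_one_div, div_le_iff₀ (by positivity), ← mul_le_mul_iff_right₀ hz0, ← mul_assoc,
    mul_inv_cancel₀ hz0.ne', one_mul]
  nlinarith [sq_nonneg (‖z‖ ^ 2), mul_nonneg hz0.le (sq_nonneg (‖z‖ - 1)), sq_nonneg ‖z‖]

/-- `(1/2π) log |z - a|` is the fundamental solution of the Laplacian of the plane. -/
theorem integral_log_norm_sub_mul_laplacian {φ : ℂ → ℝ} (hφ : ContDiff ℝ ∞ φ)
    (hs : HasCompactSupport φ) (a : ℂ) :
    ∫ z, Real.log ‖z - a‖ * Laplacian.laplacian φ z = 2 * Real.pi * φ a := by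
  have hc := continuous_laplacian hφ
  have hcs := hasCompactSupport_laplacian hφ hs
  obtain ⟨C, ρ, hC, hρ⟩ := exists_bound_of_hasCompactSupport hc hcs
  have hne : ∀ᵐ z : ℂ, z ≠ a := by
    simp [ae_iff]
  have h1 : Tendsto (fun c : ℝ => ∫ z, smoothLog a c⁻¹ z * Laplacian.laplacian φ z) atTop
      (𝓝 (∫ z, Real.log ‖z - a‖ * Laplacian.laplacian φ z)) := by
    refine tendsto_integral_filter_of_dominated_convergence
      (fun z => ‖Real.log ‖z - a‖ * Laplacian.laplacian φ z‖
        + ‖smoothLog a 1 z * Laplacian.laplacian φ z‖) ?_ ?_ ?_ ?_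
    · filter_upwards [eventually_gt_atTop 0] with c hc0
      exact ((contDiff_smoothLog a (inv_pos.2 hc0)).continuous.mul hc).aestronglyMeasurable
    · filter_upwards [eventually_ge_atTop 1] with c hc1
      filter_upwards [hne] with z hz
      have hε : |c⁻¹| ≤ 1 := by
        rw [abs_of_pos (by positivity)]
        exact inv_le_one_of_one_le₀ hc1
      rw [norm_mul, norm_mul, norm_mul, ← add_mul]
      refine mul_le_mul_of_nonneg_right ((abs_smoothLog_le hz hε).trans ?_) (norm_nonneg _)
      exact add_le_add_right (le_abs_self _) _
    · exact (integrable_log_norm_sub_mul hc.measurable hC hρ le_rfl).1.norm.add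
        (((contDiff_smoothLog a one_pos).continuous.mul hc).integrable_of_hasCompactSupport
          hcs.mul_left).norm
    · filter_upwards [hne] with z hz
      exact (tendsto_smoothLog hz).mul_const _
  -- After Green's identity the same integrals test `φ` against an approximate identity, with `c =
  -- ε⁻¹`, and tend to `2π φ(a)`.
  have h2 := (tendsto_integral_comp_smul_smul_of_integrable' (μ := volume)
    (fun z : ℂ => by positivity) integral_kernel_eq_one tendsto_kernel_cobounded
    (hφ.continuous.integrable_of_hasCompactSupport hs)
    (hφ.continuous.continuousAt (x := a))).const_mul (2 * Real.pi)
  refine tendsto_nhds_unique h1 (h2.congr' ?_)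
  filter_upwards [eventually_gt_atTop 0] with c hc0
  rw [integral_mul_laplacian (contDiff_smoothLog a (inv_pos.2 hc0)) hφ hs, ← integral_const_mul]
  refine integral_congr_ae (Eventually.of_forall fun z => ?_)
  have h0 : 0 < ‖z - a‖ ^ 2 * c ^ 2 + 1 := by positivity
  simp only [laplacian_smoothLog a (inv_pos.2 hc0), Complex.finrank_real_complex, norm_smul,
    norm_sub_rev a z, smul_eq_mul, Real.norm_eq_abs, abs_of_pos hc0]
  rw [← mul_assoc]
  congr 1
  field_simp

end LogPotential

/-! ### The Riesz measure of the Lyapunov exponent and weak convergence -/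

section RieszMeasure

section Potential

variable {N : Measure ℝ} [IsProbabilityMeasure N] {R : ℝ}

/-- The poles `t` stay in `[-R, R]`, so the kernel bound is uniform in `t` and Fubini applies to the
logarithmic potential. -/
theorem integrable_prod_log_norm_sub_mul (hN : ∀ᵐ t ∂N, t ∈ Set.Icc (-R) R) {h : ℂ → ℝ} {C ρ : ℝ}
    (hh : Measurable h) (hC : ∀ z, |h z| ≤ C) (hρ : ∀ z, ρ ≤ ‖z‖ → h z = 0) :
    Integrable (fun p : ℂ × ℝ => Real.log ‖p.1 - p.2‖ * h p.1) (volume.prod N) := by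
  have hm : Measurable fun p : ℂ × ℝ => Real.log ‖p.1 - p.2‖ * h p.1 := by fun_prop
  have hb : ∀ᵐ t : ℝ ∂N, Integrable (fun z : ℂ => Real.log ‖z - t‖ * h z) ∧
      ∫ z : ℂ, ‖Real.log ‖z - t‖ * h z‖
        ≤ C * ∫ z in Metric.ball (0 : ℂ) (ρ + R), |Real.log ‖z‖| := by
    filter_upwards [hN] with t ht
    refine integrable_log_norm_sub_mul hh hC hρ ?_
    rw [Complex.norm_real, Real.norm_eq_abs]
    linarith [abs_le.2 ht]
  rw [integrable_prod_iff' hm.aestronglyMeasurable]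
  refine ⟨hb.mono fun t ht => ht.1, (integrable_const
    (C * ∫ z in Metric.ball (0 : ℂ) (ρ + R), |Real.log ‖z‖|)).mono'
    hm.norm.aestronglyMeasurable.prod_swap.integral_prod_right' (hb.mono fun t ht => ?_)⟩
  rw [Real.norm_of_nonneg (integral_nonneg fun _ => norm_nonneg _)]
  exact ht.2

theorem locallyIntegrable_logPotential (hN : ∀ᵐ t ∂N, t ∈ Set.Icc (-R) R) :
    LocallyIntegrable fun z : ℂ => ∫ t : ℝ, Real.log ‖z - t‖ ∂N := by
  intro a
  have hmem : Metric.ball (0 : ℂ) (‖a‖ + 1) ∈ 𝓝 a :=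
    Metric.isOpen_ball.mem_nhds (by rw [mem_ball_zero_iff]; linarith)
  refine ⟨_, hmem, ?_⟩
  rw [← integrable_indicator_iff Metric.isOpen_ball.measurableSet]
  have h := (integrable_prod_log_norm_sub_mul hN (C := 1) (ρ := ‖a‖ + 1)
    (h := (Metric.ball (0 : ℂ) (‖a‖ + 1)).indicator fun _ => 1)
    (measurable_const.indicator Metric.isOpen_ball.measurableSet) (fun z => ?_)
    fun z hz => ?_).integral_prod_left
  · refine h.congr (Eventually.of_forall fun z => ?_)
    by_cases hz : z ∈ Metric.ball (0 : ℂ) (‖a‖ + 1) <;> simp only [hz, Set.indicator_of_mem,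
      Set.indicator_of_notMem, not_false_eq_true, mul_one, mul_zero, integral_zero]
  · by_cases hz : z ∈ Metric.ball (0 : ℂ) (‖a‖ + 1) <;> simp [hz]
  · exact Set.indicator_of_notMem (by rw [mem_ball_zero_iff]; exact not_lt.2 hz) _

theorem integral_logPotential_mul_laplacian (hN : ∀ᵐ t ∂N, t ∈ Set.Icc (-R) R) {φ : ℂ → ℝ}
    (hφ : ContDiff ℝ ∞ φ) (hs : HasCompactSupport φ) :
    ∫ z : ℂ, (∫ t : ℝ, Real.log ‖z - t‖ ∂N) * Laplacian.laplacian φ z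
      = 2 * Real.pi * ∫ t : ℝ, φ t ∂N := by
  have hc := continuous_laplacian hφ
  obtain ⟨C, ρ, hC, hρ⟩ := exists_bound_of_hasCompactSupport hc (hasCompactSupport_laplacian hφ hs)
  simp_rw [← integral_mul_const]
  rw [integral_integral_swap (integrable_prod_log_norm_sub_mul hN hc.measurable hC hρ)]
  simp_rw [integral_log_norm_sub_mul_laplacian hφ hs, integral_const_mul]

end Potential

theorem ae_im_ne_zero : ∀ᵐ z : ℂ, z.im ≠ 0 := by
  have h := Measure.addHaar_submodule (volume : Measure ℂ) (LinearMap.ker Complex.imLm) fun h => by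
    have h1 : Complex.I ∈ LinearMap.ker Complex.imLm := h ▸ Submodule.mem_top
    simp at h1
  rw [ae_iff]
  convert h using 2
  ext z
  simp

variable {X : Type*} [TopologicalSpace X] [CompactSpace X] [MeasurableSpace X] [BorelSpace X]
  {μ : Measure X} [IsProbabilityMeasure μ] {T : X ≃ᵐ X} {v : C(X, ℝ)}

/-- The Thouless formula: the Riesz measure of the Lyapunov exponent is the density of states. -/
theorem isRieszMeasure_lyapunov (hT : Ergodic T μ) {N : Measure ℝ} [IsProbabilityMeasure N] {R : ℝ}
    (hR : ∀ᵐ t ∂N, t ∈ Set.Icc (-R) R)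
    (hN : ∀ φ : ℝ → ℝ, Continuous φ → ∫ t, φ t ∂N = dosFunctional μ T v φ) :
    IsRieszMeasure (lyapunov μ T.toEquiv v) (N.map Complex.ofReal) := by
  -- The Thouless formula is known off the real axis only. That axis is Lebesgue null, so neither
  -- local integrability nor the distributional Laplacian sees it.
  have hL : ∀ᵐ z : ℂ, ∫ t : ℝ, Real.log ‖z - t‖ ∂N = lyapunov μ T.toEquiv v z := by
    filter_upwards [ae_im_ne_zero] with z hz
    rw [lyapunov_eq_dosFunctional hT hz, hN _ (continuous_log_norm_sub hz)]
  have := Measure.isProbabilityMeasure_map (μ := N) Complex.measurable_ofReal.aemeasurable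
  refine ⟨(locallyIntegrable_logPotential hR).congr hL, inferInstance, fun φ hφ hs => ?_⟩
  rw [integral_map Complex.measurable_ofReal.aemeasurable hφ.continuous.aestronglyMeasurable,
    ← integral_congr_ae (hL.mono fun z hz =>
      congrArg (fun y : ℝ => y * Laplacian.laplacian φ z) hz),
    integral_logPotential_mul_laplacian hR hφ hs]
  field_simp

theorem IsGeneric.weaklyConverges {x : X} (hx : IsGeneric μ T v x) (g : ℝ) {N : Measure ℝ}
    (hN : ∀ φ : ℝ → ℝ, Continuous φ → ∫ t, φ t ∂N = dosFunctional μ T v φ) :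
    WeaklyConverges (fun n => countingMeasure (truncation T.toEquiv v g x n))
      (N.map Complex.ofReal) := by
  intro f
  have hf : Continuous fun t : ℝ => f t := f.continuous.comp Complex.continuous_ofReal
  rw [integral_map Complex.measurable_ofReal.aemeasurable f.continuous.aestronglyMeasurable,
    hN _ hf]
  refine (hx.tendsto_eigenAverage hf).congr fun n => ?_
  have hV : ∀ n, conj (potential T.toEquiv v x n) = potential T.toEquiv v x n :=
    conj_potential T.toEquiv v x
  rw [eigenAverage_eq hV, integral_countingMeasure, charpoly_truncation,
    ← sum_roots_of_isHermitian (isHermitian_dirichlet hV n) f]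
  rfl

end RieszMeasure

end HatanoNelson

end

/-! ### The theorem -/

open HatanoNelson in
theorem propositionA3 {X : Type*} [TopologicalSpace X] [CompactSpace X] [MeasurableSpace X]
    [BorelSpace X] (μ : MeasureTheory.Measure X) [MeasureTheory.IsProbabilityMeasure μ]
    (T : X ≃ᵐ X) (hT : Ergodic T μ) (v : C(X, ℝ)) (g : ℝ) (hg : 0 < g) :
    -- the limit defining the Lyapunov exponent exists
    (∀ E : ℂ, Filter.Tendsto (finiteLyapunov μ T.toEquiv v E) Filter.atTop
      (nhds (lyapunov μ T.toEquiv v E))) ∧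
    ∃ N : MeasureTheory.Measure ℂ,
      MeasureTheory.IsProbabilityMeasure N ∧
      IsRieszMeasure (lyapunov μ T.toEquiv v) N ∧
      -- convergence of the counting measures, almost surely, and everywhere if uniquely ergodic
      (∀ᵐ x ∂μ, WeaklyConverges (fun n => countingMeasure (truncation T.toEquiv v g x n)) N) ∧
      (T2Space X → IsUniquelyErgodic T.toEquiv μ →
        ∀ x : X, WeaklyConverges (fun n => countingMeasure (truncation T.toEquiv v g x n)) N) ∧
      -- the almost sure spectra exist and agree with the support of the limit
      ∃ Sg S0 : Set ℂ,
        (∀ᵐ x ∂μ, spectrum ℂ (opWeighted g (potential T.toEquiv v x)) = Sg) ∧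
        (∀ᵐ x ∂μ, spectrum ℂ (opL2 0 (potential T.toEquiv v x)) = S0) ∧
        N.support = Sg ∧ Sg = S0 := by
  obtain ⟨N, hNp, hR, hN⟩ := exists_densityOfStates μ T v
  have hgen := ae_isGeneric (v := v) hT
  have hspec := ae_real_spectrum_eq_support hT hN
  have hS : ∀ᵐ x ∂μ, spectrum ℂ (opL2 0 (potential T.toEquiv v x))
      = (N.map Complex.ofReal).support := by
    filter_upwards [hspec] with x hx
    rw [support_map_ofReal, ← hx]
    exact spectrum_complex_eq_image (isSelfAdjoint_schrodinger T.toEquiv v x)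
  refine ⟨tendsto_finiteLyapunov hT.toMeasurePreserving v.continuous.measurable
      fun x => v.norm_coe_le_norm x, N.map Complex.ofReal,
    MeasureTheory.Measure.isProbabilityMeasure_map Complex.measurable_ofReal.aemeasurable,
    isRieszMeasure_lyapunov hT hR hN, hgen.mono fun x hx => hx.weaklyConverges g hN,
    fun _ hu x => (isGeneric_of_isUniquelyErgodic hu x).weaklyConverges g hN,
    _, _, hS.mono fun x hx => ?_, hS, rfl, rfl⟩
  rw [spectrum_opWeighted, hx]
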